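/- A metric Steiner Tree instance $(V,T,w)$ consists of a set $V$ of $n$ vertices, a set $T\subseteq V$ of $k$ terminals and a metric $w$ on $V$ (symmetric, positive on distinct vertices, satisfying the triangle inequality). Its cost $\mathsf{ST}(V,T,w)$ is the minimum, over all trees $\tau$ in the complete graph on $V$ whose vertex set contains $T$, of the total weight $\sum_{uv\in E(\tau)}w(u,v)$. A randomized algorithm knows $V$ and $T$, and may adaptively query values $w(u,v)$; it estimates the cost to within a factor $\alpha$ if it outputs a number $X$ with $\mathsf{ST}(V,T,w)\le X\le\alpha\cdot\mathsf{ST}(V,T,w)$. **Theorem.** There are universal constants $c,C>0$ such that the following holds for every $0<\varepsilon<2/3$ and every integer $k\ge C\cdot 2^{1/\varepsilon}$. For all sufficiently large $n$ (depending on $\varepsilon$ and $k$), every randomized algorithm that, on every metric Steiner Tree instance with $n$ vertices and $k$ terminals, with probability at least $0.51$ estimates the Steiner Tree cost to within a factor of $5/3-\varepsilon$ performs, on some such instance, at least $c\cdot n^2/4^{1/\varepsilon}$ queries in expectation (and hence also in the worst case). In particular, the bound $\Omega(n^2/4^{1/\varepsilon})$ holds for algorithms that succeed with high probability, even when $k$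 is a constant. -/

import Mathlib

namespace SteinerQuery

/-- A metric on the vertex set `V`, that is, a complete graph on `V` with positive edge weights
that satisfy the triangle inequality. -/
structure Metric (V : Type*) where
  w : V → V → ℝ
  self : ∀ u, w u u = 0
  pos : ∀ u v, u ≠ v → 0 < w u v
  symm : ∀ u v, w u v = w v u
  triangle : ∀ u v x, w u v ≤ w u x + w x v

/-- The weight of an edge (unordered pair of vertices). -/
def Metric.edgeWeight {V : Type*} (m : Metric V) : Sym2 V → ℝ :=
  Sym2.lift ⟨m.w, m.symm⟩

/-- The total weight of a subgraph of the complete graph on `V`. -/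
noncomputable def Metric.weight {V : Type*} (m : Metric V)
    (H : (⊤ : SimpleGraph V).Subgraph) : ℝ :=
  ∑ᶠ e ∈ H.edgeSet, m.edgeWeight e

/-- `H` is a Steiner tree for the terminal set `T`: a tree in the complete graph on `V` whose vertex
set contains all terminals. -/
def IsSteinerTree {V : Type*} (T : Finset V) (H : (⊤ : SimpleGraph V).Subgraph) : Prop :=
  H.coe.IsTree ∧ (T : Set V) ⊆ H.verts

/-- The minimum weight of a Steiner tree of the instance `(V, T, m)`. For finite nonempty `V` the
infimum is over a finite nonempty set. -/
noncomputable def Metric.steinerCost {V : Type*} (m : Metric V) (T : Finset V) : ℝ :=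
  sInf {x | ∃ H : (⊤ : SimpleGraph V).Subgraph, IsSteinerTree T H ∧ m.weight H = x}

/-- A deterministic adaptive query algorithm, as a decision tree: it either stops with an output,
or queries the weight of a pair of vertices and continues depending on the answer. -/
inductive QueryTree (V : Type*) where
  | output (x : ℝ) : QueryTree V
  | query (u v : V) (next : ℝ → QueryTree V) : QueryTree V

/-- The output of the decision tree when the queries are answered by `m`. -/
def QueryTree.eval {V : Type*} (m : Metric V) : QueryTree V → ℝ
  | .output x => x
  | .query u v next => (next (m.w u v)).eval m

/-- The number of queries that the decision tree performs when they are answered by `m`. -/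
def QueryTree.numQueries {V : Type*} (m : Metric V) : QueryTree V → ℕ
  | .output _ => 0
  | .query u v next => (next (m.w u v)).numQueries m + 1

/-- A randomized query algorithm with random coins from `Ω`: for every terminal set (which is known
to the algorithm) and every outcome of the coins a decision tree, such that the output and the
number of queries on each instance are random variables. -/
structure RandomizedAlgorithm (V Ω : Type*) [MeasurableSpace Ω] where
  run : Finset V → Ω → QueryTree V
  measurable_eval : ∀ (T : Finset V) (m : Metric V), Measurable fun ω => (run T ω).eval m
  measurable_numQueries :
    ∀ (T : Finset V) (m : Metric V), Measurable fun ω => (run T ω).numQueries m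

/-- On every instance with vertex set `V` and `k` terminals, the algorithm outputs with probability
at least `p` a number between the Steiner cost and `α` times the Steiner cost. -/
def RandomizedAlgorithm.Estimates {V Ω : Type*} [MeasurableSpace Ω]
    (A : RandomizedAlgorithm V Ω) (μ : MeasureTheory.Measure Ω) (k : ℕ) (α p : ℝ) : Prop :=
  ∀ (T : Finset V) (m : Metric V), T.card = k →
    p ≤ μ.real {ω | m.steinerCost T ≤ (A.run T ω).eval m ∧
      (A.run T ω).eval m ≤ α * m.steinerCost T}

/-- The expected number of queries that the algorithm performs on the instance `(V, T, m)`. -/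
noncomputable def RandomizedAlgorithm.expectedQueries {V Ω : Type*} [MeasurableSpace Ω]
    (A : RandomizedAlgorithm V Ω) (μ : MeasureTheory.Measure Ω) (T : Finset V) (m : Metric V) : ENNReal :=
  ∫⁻ ω, ((A.run T ω).numQueries m : ENNReal) ∂μ

end SteinerQuery

namespace SteinerQuery

/-! ### The Fibonacci weights -/

/-! One expensive instance is hidden among many cheap ones. The terminals sit at the leaves of a
complete binary tree of height `h`, of order `1 / ε`, with surplus terminals crowded at leaf `0`.
Each node of height `j ≥ 1` carries a group of at least `s` interchangeable Steiner vertices, where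
`s` is of order `n / (h * 2 ^ h)`, at distance `depth j` from the leaves below. In the plain metric
every path runs through a leaf. In a shortcut metric one secret vertex per node is chosen, and
chosen vertices see each other along the tree. The two metrics differ only on pairs of chosen
vertices, and a given pair is chosen in at most a fraction `1 / s ^ 2` of all choices. Double
counting (`RandomizedAlgorithm.le_expectedQueries`) then forces `s ^ 2 / 50` expected queries on the
plain instance.

The chosen vertices span the binary tree, of weight `3 * 2 ^ h` up to Fibonacci terms
(`steinerCost_shortcutMetric_le`). The plain instance costs at least `5 * 2 ^ h` up to such terms
(`le_steinerCost_plainMetric`): reroute each edge of a Steiner tree through a leaf below its lower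
end, which turns the tree into stars from vertices to leaf positions. A star costs at least a
minimum spanning tree of its leaves for the ultrametric `price (lca p q)` (`mergePrice_le_star`),
and at each level the stars together must connect all clusters (`two_pow_sub_one_le_sum`), so they
pay for a spanning tree of all leaves. Fibonacci numbers are small against `2 ^ h / h`, so the ratio
of the costs exceeds `5 / 3 - 1 / (2 * h)`.

The star bound rests on `depth i ≤ saving (i + 2)` and `price i ≤ depth (i + 1)`. Both reduce to
`saving j + saving (j + 1) ≤ saving (j + 2)`, hence the Fibonacci weights. -/

/-- The saving that a merge at height `j` may contribute. -/
def saving (j : ℕ) : ℝ := (Nat.fib (j - 1) : ℝ)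

/-- The distance from a tree node of height `j` to the leaves below it. -/
def depth (j : ℕ) : ℝ := saving j + saving (j + 1)

/-- The price of a merge at height `j`. -/
def price (j : ℕ) : ℝ := saving j + 2 * saving (j + 1)

lemma saving_nonneg (j : ℕ) : 0 ≤ saving j := Nat.cast_nonneg _

lemma saving_zero : saving 0 = 0 := by simp [saving]

lemma saving_one : saving 1 = 0 := by simp [saving]

lemma saving_mono : Monotone saving := fun i j h => by
  unfold saving
  exact_mod_cast Nat.fib_mono (Nat.sub_le_sub_right h 1)

/-- The Fibonacci recursion, strict only at `j = 0`: truncated subtraction gives `saving 0 = 0`, so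
that leaves have depth `0`. -/
lemma saving_add_le (j : ℕ) : saving j + saving (j + 1) ≤ saving (j + 2) := by
  cases j with
  | zero => simp [saving]
  | succ j =>
    simp only [saving, Nat.add_sub_cancel]
    exact_mod_cast (Nat.fib_add_two (n := j)).ge

lemma depth_zero : depth 0 = 0 := by simp [depth, saving_zero, saving_one]

lemma depth_add_one_le (j : ℕ) : depth j + 1 ≤ depth (j + 1) := by
  have h : saving j + 1 ≤ saving (j + 2) := by
    cases j with
    | zero => simp [saving]
    | succ j =>
      simp only [saving, Nat.add_sub_cancel]
      have h1 := Nat.fib_add_two (n := j)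
      have h2 : 0 < Nat.fib (j + 1) := Nat.fib_pos.2 (Nat.succ_pos j)
      exact_mod_cast (by omega : Nat.fib j + 1 ≤ Nat.fib (j + 2))
  unfold depth
  linarith

lemma depth_strictMono : StrictMono depth :=
  strictMono_nat_of_lt_succ fun j => by linarith [depth_add_one_le j]

lemma depth_nonneg (j : ℕ) : 0 ≤ depth j := add_nonneg (saving_nonneg _) (saving_nonneg _)

lemma price_zero : price 0 = 0 := by simp [price, saving_zero, saving_one]

lemma price_mono : Monotone price := fun i j h => by
  have h1 := saving_mono h
  have h2 := saving_mono (Nat.succ_le_succ h)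
  simp only [price, Nat.succ_eq_add_one] at *
  linarith

lemma price_le_depth_succ (j : ℕ) : price j ≤ depth (j + 1) := by
  have := saving_add_le j
  unfold price depth
  linarith

/-! ### Lowest common ancestors of leaf positions -/

lemma exists_div_two_pow_eq (p q : ℕ) : ∃ l, p / 2 ^ l = q / 2 ^ l :=
  ⟨max p q, by
    rw [Nat.div_eq_of_lt ((le_max_left p q).trans_lt Nat.lt_two_pow_self),
      Nat.div_eq_of_lt ((le_max_right p q).trans_lt Nat.lt_two_pow_self)]⟩

/-- The height of the lowest common ancestor of two leaf positions in the binary tree. -/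
def lca (p q : ℕ) : ℕ := Nat.find (exists_div_two_pow_eq p q)

lemma div_two_pow_eq_mono {p q l l' : ℕ} (hl : l ≤ l') (h : p / 2 ^ l = q / 2 ^ l) :
    p / 2 ^ l' = q / 2 ^ l' := by
  obtain ⟨d, rfl⟩ := Nat.exists_eq_add_of_le hl
  rw [pow_add, ← Nat.div_div_eq_div_mul, h, Nat.div_div_eq_div_mul]

lemma lca_le_iff {p q l : ℕ} : lca p q ≤ l ↔ p / 2 ^ l = q / 2 ^ l :=
  ⟨fun h => div_two_pow_eq_mono h (Nat.find_spec (exists_div_two_pow_eq p q)),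
    fun h => Nat.find_min' _ h⟩

lemma lca_comm (p q : ℕ) : lca p q = lca q p :=
  le_antisymm (lca_le_iff.2 (lca_le_iff.1 le_rfl).symm) (lca_le_iff.2 (lca_le_iff.1 le_rfl).symm)

lemma lca_self (p : ℕ) : lca p p = 0 := Nat.le_zero.1 (lca_le_iff.2 rfl)

lemma lca_le_max (p q r : ℕ) : lca p r ≤ max (lca p q) (lca q r) :=
  lca_le_iff.2 ((lca_le_iff.1 (le_max_left _ _)).trans (lca_le_iff.1 (le_max_right _ _)))

/-! ### The price of connecting a set of leaf positions -/

/-- The clusters of height `l` that meet `K`. -/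
def clusters (l : ℕ) (K : Finset ℕ) : Finset ℕ := K.image (· / 2 ^ l)

/-- The minimum price of a spanning tree of a set `K` of leaf positions, level by level. -/
noncomputable def mergePrice (h : ℕ) (K : Finset ℕ) : ℝ :=
  ∑ l ∈ Finset.range h, (price (l + 1) - price l) * (((clusters l K).card : ℝ) - 1)

lemma price_diff_nonneg (l : ℕ) : 0 ≤ price (l + 1) - price l :=
  sub_nonneg.2 (price_mono l.le_succ)

lemma card_clusters_le (l : ℕ) (K : Finset ℕ) : (clusters l K).card ≤ K.card :=
  Finset.card_image_le

lemma card_clusters_le_one {l : ℕ} {K : Finset ℕ} (a : ℕ) (hK : ∀ p ∈ K, p / 2 ^ l = a) :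
    (clusters l K).card ≤ 1 := by
  refine Finset.card_le_one_iff_subset_singleton.2 ⟨a, ?_⟩
  intro b hb
  obtain ⟨p, hp, rfl⟩ := Finset.mem_image.1 hb
  simp [hK p hp]

lemma card_clusters_le_one_of_le {j l : ℕ} (hjl : j ≤ l) {K : Finset ℕ} (q : ℕ)
    (hK : ∀ p ∈ K, p / 2 ^ j = q / 2 ^ j) : (clusters l K).card ≤ 1 :=
  card_clusters_le_one (q / 2 ^ l) fun p hp => div_two_pow_eq_mono hjl (hK p hp)

lemma one_le_card_clusters {l : ℕ} {K : Finset ℕ} (hK : K.Nonempty) :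
    (1 : ℝ) ≤ (clusters l K).card := by
  exact_mod_cast Finset.card_pos.2 (hK.image _)

/-- A bound on a level sum of which only the levels below `j` contribute. -/
lemma sum_price_diff_le (h j : ℕ) {a : ℝ} (ha : 0 ≤ a) :
    ∑ l ∈ Finset.range h, (price (l + 1) - price l) * (if l < j then a else 0) ≤ a * price j := by
  calc ∑ l ∈ Finset.range h, (price (l + 1) - price l) * (if l < j then a else 0)
      = ∑ l ∈ (Finset.range h).filter (· < j), (price (l + 1) - price l) * a := by
        rw [Finset.sum_filter]
        exact Finset.sum_congr rfl fun l _ => by split_ifs <;> simp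
    _ ≤ ∑ l ∈ Finset.range j, (price (l + 1) - price l) * a := by
        refine Finset.sum_le_sum_of_subset_of_nonneg (fun l hl => ?_)
          fun l _ _ => mul_nonneg (price_diff_nonneg l) ha
        exact Finset.mem_range.2 (Finset.mem_filter.1 hl).2
    _ = a * price j := by
        rw [← Finset.sum_mul, Finset.sum_range_sub, price_zero]
        ring

lemma mergePrice_le_of_same {h j : ℕ} {K : Finset ℕ} (hne : K.Nonempty) (q : ℕ)
    (hK : ∀ p ∈ K, p / 2 ^ j = q / 2 ^ j) : mergePrice h K ≤ ((K.card : ℝ) - 1) * price j := by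
  have hc : (1 : ℝ) ≤ K.card := by exact_mod_cast Finset.card_pos.2 hne
  refine le_trans (Finset.sum_le_sum fun l _ => mul_le_mul_of_nonneg_left ?_
    (price_diff_nonneg l)) (sum_price_diff_le h j (sub_nonneg.2 hc))
  split_ifs with hl
  · have : ((clusters l K).card : ℝ) ≤ K.card := by exact_mod_cast card_clusters_le l K
    linarith
  · have : ((clusters l K).card : ℝ) ≤ 1 := by
      exact_mod_cast card_clusters_le_one_of_le (not_lt.1 hl) q hK
    linarith

lemma card_clusters_le_two {j q : ℕ} {K : Finset ℕ}
    (hK : ∀ p ∈ K, p / 2 ^ (j + 1) = q / 2 ^ (j + 1)) : (clusters j K).card ≤ 2 := by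
  refine le_trans (Finset.card_le_card (t := {2 * (q / 2 ^ (j + 1)), 2 * (q / 2 ^ (j + 1)) + 1})
    ?_) Finset.card_le_two
  intro b hb
  obtain ⟨p, hp, rfl⟩ := Finset.mem_image.1 hb
  have h := hK p hp
  have h1 : p / 2 ^ (j + 1) = p / 2 ^ j / 2 := by rw [pow_succ, Nat.div_div_eq_div_mul]
  simp only [Finset.mem_insert, Finset.mem_singleton]
  omega

/-- At most one merge happens at height `j + 1`, between the two children; all others stay inside a
child. -/
lemma mergePrice_le_of_same_parent {h j : ℕ} {K : Finset ℕ} (h2 : 2 ≤ K.card) (q : ℕ)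
    (hK : ∀ p ∈ K, p / 2 ^ (j + 1) = q / 2 ^ (j + 1)) :
    mergePrice h K ≤ price (j + 1) + ((K.card : ℝ) - 2) * price j := by
  have hc : (2 : ℝ) ≤ K.card := by exact_mod_cast h2
  have key : mergePrice h K ≤
      ∑ l ∈ Finset.range h, (price (l + 1) - price l) * (if l < j + 1 then 1 else 0) +
      ∑ l ∈ Finset.range h, (price (l + 1) - price l) * (if l < j then (K.card : ℝ) - 2 else 0) := by
    rw [← Finset.sum_add_distrib]
    refine Finset.sum_le_sum fun l _ => ?_
    rw [← mul_add]
    refine mul_le_mul_of_nonneg_left ?_ (price_diff_nonneg l)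
    rcases lt_trichotomy l j with hl | hl | hl
    · have : ((clusters l K).card : ℝ) ≤ K.card := by exact_mod_cast card_clusters_le l K
      rw [if_pos (by omega), if_pos hl]
      linarith
    · subst hl
      have : ((clusters l K).card : ℝ) ≤ 2 := by exact_mod_cast card_clusters_le_two hK
      rw [if_pos (by omega), if_neg (by omega)]
      linarith
    · have : ((clusters l K).card : ℝ) ≤ 1 := by
        exact_mod_cast card_clusters_le_one_of_le hl q hK
      rw [if_neg (by omega), if_neg (by omega)]
      linarith
  have h3 := sum_price_diff_le h (j + 1) zero_le_one
  have h4 := sum_price_diff_le h j (sub_nonneg.2 hc)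
  linarith

lemma mergePrice_union_le {h j : ℕ} {K K' : Finset ℕ} (hne : K.Nonempty) (hne' : K'.Nonempty)
    (q : ℕ) (hK : ∀ p ∈ K ∪ K', p / 2 ^ j = q / 2 ^ j) :
    mergePrice h (K ∪ K') ≤ mergePrice h K + mergePrice h K' + price j := by
  have key : mergePrice h (K ∪ K') ≤ mergePrice h K + mergePrice h K' +
      ∑ l ∈ Finset.range h, (price (l + 1) - price l) * (if l < j then 1 else 0) := by
    unfold mergePrice
    rw [← Finset.sum_add_distrib, ← Finset.sum_add_distrib]
    refine Finset.sum_le_sum fun l _ => ?_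
    rw [← mul_add, ← mul_add]
    refine mul_le_mul_of_nonneg_left ?_ (price_diff_nonneg l)
    have h1 := one_le_card_clusters (l := l) hne
    have h2 := one_le_card_clusters (l := l) hne'
    split_ifs with hl
    · have : ((clusters l (K ∪ K')).card : ℝ) ≤ (clusters l K).card + (clusters l K').card := by
        unfold clusters
        rw [Finset.image_union]
        exact_mod_cast Finset.card_union_le _ _
      linarith
    · have : ((clusters l (K ∪ K')).card : ℝ) ≤ 1 := by
        exact_mod_cast card_clusters_le_one_of_le (not_lt.1 hl) q hK
      linarith
  have h3 := sum_price_diff_le h j zero_le_one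
  linarith

/-! ### Stars cost at least as much as merging their leaves -/

/-- The height at which the tree node of height `i` above `q` meets the leaf `p`. -/
def meet (i q p : ℕ) : ℕ := max i (lca p q)

/-- Leaves are added in order of the height at which they meet the centre. While all of them lie
below the centre, the star is too expensive by `saving i`. That slack pays for the first step
outside, where the price of the merge exceeds the cost of one leg by up to `saving i`; later steps
need no slack. -/
lemma star_slack (h i q : ℕ) (K : Finset ℕ) (d : ℕ) :
    let S := K.filter (fun p => meet i q p ≤ i + d)
    S.Nonempty → (if d = 0 then saving i else 0) + mergePrice h S ≤
      ∑ p ∈ S, (2 * depth (meet i q p) - depth i) := by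
  induction d with
  | zero =>
    intro S hS
    have hm : ∀ p ∈ S, meet i q p = i := fun p hp =>
      le_antisymm (Finset.mem_filter.1 hp).2 (le_max_left _ _)
    have hq : ∀ p ∈ S, p / 2 ^ i = q / 2 ^ i := fun p hp =>
      lca_le_iff.1 ((le_max_right _ _).trans (hm p hp).le)
    rw [Finset.sum_congr rfl fun p hp => by rw [hm p hp], Finset.sum_const, nsmul_eq_mul,
      if_pos rfl]
    have hc : 0 < S.card := Finset.card_pos.2 hS
    have hs := saving_nonneg (i + 1)
    rcases Nat.lt_or_ge S.card 2 with h1 | h2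
    · have h1 : S.card = 1 := by omega
      have := mergePrice_le_of_same (h := h) hS q hq
      rw [h1] at this ⊢
      simp only [depth]
      push_cast at *
      linarith
    · cases i with
      | zero =>
        exfalso
        have : S.card ≤ 1 := Finset.card_le_one.2 fun a ha b hb => by
          have h1 := hq a ha
          have h2 := hq b hb
          simp only [pow_zero, Nat.div_one] at h1 h2
          rw [h1, h2]
        omega
      | succ j =>
        have h3 := mergePrice_le_of_same_parent (h := h) h2 q hq
        have h4 := price_le_depth_succ j
        have h5 : (2 : ℝ) ≤ S.card := by exact_mod_cast h2
        have h6 := mul_le_mul_of_nonneg_left h4 (sub_nonneg.2 h5)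
        have h7 : price (j + 1) + saving (j + 1) = 2 * depth (j + 1) := by
          unfold price depth; ring
        linarith
  | succ d ih =>
    intro S hS
    rw [if_neg d.succ_ne_zero, zero_add]
    set S' := K.filter (fun p => meet i q p ≤ i + d) with hS'
    set R := K.filter (fun p => meet i q p = i + (d + 1)) with hR
    have hSR : S = S' ∪ R := by
      ext p
      simp only [S, S', R, Finset.mem_union, Finset.mem_filter, ← and_or_left]
      refine and_congr_right fun _ => ?_
      omega
    have hdisj : Disjoint S' R := by
      refine Finset.disjoint_left.2 fun p h1 h2 => ?_
      have h1 := (Finset.mem_filter.1 h1).2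
      have h2 := (Finset.mem_filter.1 h2).2
      omega
    have hl : ∀ p ∈ R, lca p q = i + d + 1 := fun p hp => by
      have h1 := (Finset.mem_filter.1 hp).2
      simp only [meet] at h1
      omega
    have hsum : ∑ p ∈ R, (2 * depth (meet i q p) - depth i) =
        R.card * (2 * depth (i + d + 1) - depth i) := by
      rw [Finset.sum_congr rfl fun p hp => by rw [(Finset.mem_filter.1 hp).2], Finset.sum_const,
        nsmul_eq_mul]
      rfl
    rw [hSR] at hS ⊢
    rw [Finset.sum_union hdisj, hsum]
    rcases R.eq_empty_or_nonempty with hR0 | hRne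
    · rw [hR0, Finset.union_empty] at hS ⊢
      have := ih hS
      have h1 := saving_nonneg i
      simp only [Finset.card_empty, Nat.cast_zero, zero_mul, add_zero]
      split_ifs at this <;> linarith
    obtain ⟨r, hr⟩ := hRne
    have hRne : R.Nonempty := ⟨r, hr⟩
    -- A leaf that meets the centre exactly at height `i + d + 1` lies below the sibling of the
    -- ancestor of `q` at height `i + d`.
    have hRsame : ∀ p ∈ R, p / 2 ^ (i + d) = r / 2 ^ (i + d) := by
      intro p hp
      have h1 : ∀ x ∈ R, x / 2 ^ (i + d) / 2 = q / 2 ^ (i + d) / 2 ∧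
          x / 2 ^ (i + d) ≠ q / 2 ^ (i + d) := fun x hx => by
        refine ⟨?_, fun hc => ?_⟩
        · rw [Nat.div_div_eq_div_mul, Nat.div_div_eq_div_mul, ← pow_succ]
          exact lca_le_iff.1 (hl x hx).le
        · have := lca_le_iff.2 hc
          have := hl x hx
          omega
      have h2 := h1 p hp
      have h3 := h1 r hr
      omega
    have hMR := mergePrice_le_of_same (h := h) hRne r hRsame
    have hRc : (1 : ℝ) ≤ R.card := by exact_mod_cast Finset.card_pos.2 hRne
    have hdd : depth i ≤ depth (i + d + 1) := depth_strictMono.monotone (by omega)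
    have hpd := price_le_depth_succ (i + d)
    have hprod : ((R.card : ℝ) - 1) * price (i + d) ≤
        ((R.card : ℝ) - 1) * (2 * depth (i + d + 1) - depth i) :=
      mul_le_mul_of_nonneg_left (by linarith) (sub_nonneg.2 hRc)
    rcases S'.eq_empty_or_nonempty with h0 | hne
    · rw [h0, Finset.empty_union, Finset.sum_empty]
      have := depth_nonneg (i + d + 1)
      linarith
    · have hq : ∀ p ∈ S' ∪ R, p / 2 ^ (i + d + 1) = q / 2 ^ (i + d + 1) := by
        rw [← hSR]
        intro p hp
        exact lca_le_iff.1 ((le_max_right _ _).trans (Finset.mem_filter.1 hp).2)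
      have hU := mergePrice_union_le (h := h) hne hRne q hq
      have hI := ih hne
      have hP : price (i + d + 1) + saving (i + d + 1) = 2 * depth (i + d + 1) := by
        unfold price depth; ring
      -- One leg of `R` has to pay `price (i + d + 1)`, so the shortage is `depth i - saving (i + d
      -- + 1)`. For `d = 0` it equals `saving i`, the slack; otherwise it is not positive.
      split_ifs at hI with hd
      · subst hd
        have : depth i = saving i + saving (i + 1) := rfl
        simp only [add_zero] at *
        linarith
      · have h1 : depth i ≤ saving (i + d + 1) :=
          (saving_add_le i).trans (saving_mono (by omega))
        linarith

/-- A star centred at a tree node of height `i` above `q` is at least as expensive as merging its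
leaves. -/
lemma mergePrice_le_star (h i q : ℕ) {K : Finset ℕ} (hK : K.Nonempty) :
    mergePrice h K ≤ ∑ p ∈ K, (2 * depth (meet i q p) - depth i) := by
  obtain ⟨d, hd⟩ : ∃ d, ∀ p ∈ K, meet i q p ≤ i + d := by
    refine ⟨K.sup (meet i q), fun p hp => ?_⟩
    exact (Finset.le_sup (f := meet i q) hp).trans (Nat.le_add_left _ _)
  have hf : K.filter (fun p => meet i q p ≤ i + d) = K := Finset.filter_true_of_mem hd
  have := star_slack h i q K d
  simp only [hf] at this
  have h1 := this hK
  have h2 := saving_nonneg i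
  split_ifs at h1 <;> linarith

/-- The merge price of all `2 ^ h` leaves. Passing to `h + 1` turns each level count `c` into `2 * c
+ 1`, and the increments telescope to `price (h + 1)`. -/
lemma sum_price_diff_mul (h : ℕ) :
    ∑ l ∈ Finset.range h, (price (l + 1) - price l) * ((2 : ℝ) ^ (h - l) - 1) =
      5 * 2 ^ h - 2 * Nat.fib (h + 4) + Nat.fib (h + 2) := by
  induction h with
  | zero => norm_num [Nat.fib]
  | succ h ih =>
    have e : ∀ l ∈ Finset.range (h + 1), (price (l + 1) - price l) * ((2 : ℝ) ^ (h + 1 - l) - 1) =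
        2 * ((price (l + 1) - price l) * ((2 : ℝ) ^ (h - l) - 1)) + (price (l + 1) - price l) := by
      intro l hl
      have hl := Finset.mem_range.1 hl
      rw [Nat.succ_sub (by omega), pow_succ]
      ring
    rw [Finset.sum_congr rfl e, Finset.sum_add_distrib, ← Finset.mul_sum, Finset.sum_range_succ, ih,
      Finset.sum_range_sub, price_zero]
    have f2 := Nat.fib_add_two (n := h)
    have f3 := Nat.fib_add_two (n := h + 1)
    have f4 := Nat.fib_add_two (n := h + 2)
    have f5 := Nat.fib_add_two (n := h + 3)
    simp only [price, saving, Nat.add_sub_cancel, Nat.sub_self, pow_zero, pow_succ] at *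
    have g2 : (Nat.fib (h + 2) : ℝ) = Nat.fib h + Nat.fib (h + 1) := by exact_mod_cast f2
    have g3 : (Nat.fib (h + 3) : ℝ) = Nat.fib (h + 1) + Nat.fib (h + 2) := by exact_mod_cast f3
    have g4 : (Nat.fib (h + 4) : ℝ) = Nat.fib (h + 2) + Nat.fib (h + 3) := by exact_mod_cast f4
    have g5 : (Nat.fib (h + 5) : ℝ) = Nat.fib (h + 3) + Nat.fib (h + 4) := by exact_mod_cast f5
    have e1 : h + 1 + 4 = h + 5 := by ring
    have e2 : h + 1 + 2 = h + 3 := by ring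
    rw [e1, e2]
    linarith

/-- The weight of the binary tree of height `h + 1`, with `2 ^ (h + 1 - j)` edges leaving level `j`
upwards. The closed form fails for height `0`, because `depth 0` is `0` and not `fib 1`. -/
lemma sum_depth_diff_mul (h : ℕ) :
    ∑ j ∈ Finset.range (h + 1), (2 : ℝ) ^ (h + 1 - j) * (depth (j + 1) - depth j) =
      3 * 2 ^ (h + 1) - 2 * Nat.fib (h + 3) := by
  induction h with
  | zero => norm_num [Nat.fib, depth, saving]
  | succ h ih =>
    have e : ∀ j ∈ Finset.range (h + 1), (2 : ℝ) ^ (h + 1 + 1 - j) * (depth (j + 1) - depth j) =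
        2 * ((2 : ℝ) ^ (h + 1 - j) * (depth (j + 1) - depth j)) := by
      intro j hj
      have hj := Finset.mem_range.1 hj
      rw [Nat.succ_sub (by omega), pow_succ]
      ring
    rw [Finset.sum_range_succ, Finset.sum_congr rfl e, ← Finset.mul_sum, ih]
    have g2 : (Nat.fib (h + 2) : ℝ) = Nat.fib h + Nat.fib (h + 1) := by
      exact_mod_cast Nat.fib_add_two
    have g3 : (Nat.fib (h + 3) : ℝ) = Nat.fib (h + 1) + Nat.fib (h + 2) := by
      exact_mod_cast Nat.fib_add_two
    have g4 : (Nat.fib (h + 1 + 3) : ℝ) = Nat.fib (h + 2) + Nat.fib (h + 3) := by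
      exact_mod_cast Nat.fib_add_two
    have e1 : h + 1 + 1 - (h + 1) = 1 := by omega
    simp only [depth, saving, Nat.add_sub_cancel, e1, pow_succ, pow_zero]
    linarith

/-! ### Metrics from labelled binary trees -/

/-- A placement of the vertices at nodes of the binary tree. A vertex of height `ht x` sits at the
node of that height above the leaf position `pos x`. -/
structure Placement (V : Type*) where
  pos : V → ℕ
  ht : V → ℕ

namespace Placement

variable {V : Type*} (P : Placement V)

/-- The height at which two vertices meet. -/
def join (x y : V) : ℕ := max (max (P.ht x) (P.ht y)) (lca (P.pos x) (P.pos y))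

lemma join_comm (x y : V) : P.join x y = P.join y x := by
  unfold join
  rw [max_comm (P.ht x), lca_comm]

lemma ht_le_join_left (x y : V) : P.ht x ≤ P.join x y := (le_max_left _ _).trans (le_max_left _ _)

lemma ht_le_join_right (x y : V) : P.ht y ≤ P.join x y := (le_max_right _ _).trans (le_max_left _ _)

lemma join_le_max (x y z : V) : P.join x z ≤ max (P.join x y) (P.join y z) := by
  have := lca_le_max (P.pos x) (P.pos y) (P.pos z)
  unfold join
  omega

end Placement

/-- The depth, with the value at `0` raised to `δ` in order to separate vertices at one leaf. -/
noncomputable def radius (δ : ℝ) (j : ℕ) : ℝ := if j = 0 then δ else depth j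

lemma depth_le_radius {δ : ℝ} (hδ : 0 ≤ δ) (j : ℕ) : depth j ≤ radius δ j := by
  unfold radius
  split_ifs with h
  · rw [h, depth_zero]; exact hδ
  · exact le_rfl

lemma radius_of_pos {j : ℕ} (δ : ℝ) (hj : j ≠ 0) : radius δ j = depth j := if_neg hj

lemma radius_mono {δ : ℝ} (hδ : δ ≤ 1) : Monotone (radius δ) := by
  refine monotone_nat_of_le_succ fun j => ?_
  rw [radius_of_pos δ j.succ_ne_zero]
  have h1 := depth_add_one_le j
  have h2 := depth_nonneg j
  unfold radius
  split_ifs <;> linarith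

lemma radius_pos {δ : ℝ} (hδ : 0 < δ) (j : ℕ) : 0 < radius δ j := by
  unfold radius
  split_ifs with h
  · exact hδ
  · have := depth_strictMono (Nat.pos_of_ne_zero h)
    rwa [depth_zero] at this

namespace Placement

variable {V : Type*} (P : Placement V)

open Classical in
/-- The distance saved by running from the common ancestor. Between vertices of `S` it is
the full distance in the tree. -/
noncomputable def discount (S : V → Prop) (x y : V) : ℝ :=
  if S x ∧ S y then depth (P.ht x) + depth (P.ht y) else |depth (P.ht x) - depth (P.ht y)|

open Classical in
/-- The distances of vertices placed in the binary tree: the tree distance for vertices in `S`, and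
otherwise the length of a shortest path through some leaf. -/
noncomputable def dist (δ : ℝ) (S : V → Prop) (x y : V) : ℝ :=
  if x = y then 0 else 2 * radius δ (P.join x y) - P.discount S x y

lemma discount_comm (S : V → Prop) (x y : V) : P.discount S x y = P.discount S y x := by
  unfold discount
  rw [abs_sub_comm, add_comm]
  split_ifs <;> first | rfl | (exfalso; tauto)

/-- The form needed for the triangle inequality: the discounts on the two legs exceed the direct
discount by no more than twice the radius of one leg. -/
lemma discount_triangle (S : V → Prop) (x y z : V) {a : ℝ} (hx : depth (P.ht x) ≤ a)
    (hy : depth (P.ht y) ≤ a) :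
    P.discount S x y + P.discount S y z - P.discount S x z ≤ 2 * a := by
  have h1 := depth_nonneg (P.ht x)
  have h2 := depth_nonneg (P.ht y)
  have h3 := depth_nonneg (P.ht z)
  unfold discount
  by_cases sx : S x <;> by_cases sy : S y <;> by_cases sz : S z <;>
    simp only [sx, sy, sz, and_self, and_true, and_false, if_true, if_false] <;>
    rcases abs_cases (depth (P.ht x) - depth (P.ht y)) with ⟨e1, _⟩ | ⟨e1, _⟩ <;>
    rcases abs_cases (depth (P.ht y) - depth (P.ht z)) with ⟨e2, _⟩ | ⟨e2, _⟩ <;>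
    rcases abs_cases (depth (P.ht x) - depth (P.ht z)) with ⟨e3, _⟩ | ⟨e3, _⟩ <;>
    (try simp only [e1, e2, e3]) <;> linarith

lemma dist_comm (δ : ℝ) (S : V → Prop) (x y : V) : P.dist δ S x y = P.dist δ S y x := by
  unfold dist
  rw [P.discount_comm, P.join_comm]
  split_ifs <;> first | rfl | (exfalso; tauto)

lemma dist_pos {δ : ℝ} (h0 : 0 < δ) (h1 : δ ≤ 1) {S : V → Prop}
    (hS : ∀ x y, S x → S y → P.ht x = P.ht y → P.join x y = P.ht x → x = y)
    {x y : V} (hxy : x ≠ y) : 0 < P.dist δ S x y := by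
  unfold dist discount
  rw [if_neg hxy]
  have hx : radius δ (P.ht x) ≤ radius δ (P.join x y) := radius_mono h1 (P.ht_le_join_left x y)
  have hy : radius δ (P.ht y) ≤ radius δ (P.join x y) := radius_mono h1 (P.ht_le_join_right x y)
  have hx' := depth_le_radius h0.le (P.ht x)
  have hy' := depth_le_radius h0.le (P.ht y)
  have hp := radius_pos h0 (P.join x y)
  have hnx := depth_nonneg (P.ht x)
  have hny := depth_nonneg (P.ht y)
  split_ifs with hs
  · have hlt : ∀ i, i < P.join x y → depth i < radius δ (P.join x y) := fun i hi =>
      (depth_strictMono hi).trans_le (depth_le_radius h0.le _)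
    rcases (P.ht_le_join_left x y).lt_or_eq with h | h
    · linarith [hlt _ h]
    rcases (P.ht_le_join_right x y).lt_or_eq with h' | h'
    · linarith [hlt _ h']
    -- Both vertices would sit at the same tree node, where the tree distance degenerates; `hS`
    -- excludes this.
    exact absurd (hS x y hs.1 hs.2 (h.trans h'.symm) h.symm) hxy
  · rcases abs_cases (depth (P.ht x) - depth (P.ht y)) with ⟨e, _⟩ | ⟨e, _⟩ <;> rw [e] <;> linarith

lemma dist_triangle {δ : ℝ} (h0 : 0 < δ) (h1 : δ ≤ 1) {S : V → Prop}
    (hS : ∀ x y, S x → S y → P.ht x = P.ht y → P.join x y = P.ht x → x = y) (x z y : V) :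
    P.dist δ S x z ≤ P.dist δ S x y + P.dist δ S y z := by
  have hnn : ∀ a b, 0 ≤ P.dist δ S a b := fun a b => by
    by_cases hab : a = b
    · simp [dist, hab]
    · exact (P.dist_pos h0 h1 hS hab).le
  by_cases hxy : x = y
  · subst hxy; simp [dist]
  by_cases hyz : y = z
  · subst hyz; simp [dist]
  by_cases hxz : x = z
  · subst hxz
    have h1 := hnn x y
    have h2 := hnn y x
    simp only [dist, if_true] at *
    linarith
  have hdr : ∀ {i j}, i ≤ j → depth i ≤ radius δ j := fun hij =>
    (depth_strictMono.monotone hij).trans (depth_le_radius h0.le _)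
  simp only [dist, hxy, hyz, hxz, if_false]
  have hj := P.join_le_max x y z
  -- The leg with the larger join dominates the radius of the direct pair; the radius of the other
  -- leg pays for the discounts.
  rcases le_max_iff.1 hj with h | h
  · have h2 := radius_mono h1 h
    have h3 := P.discount_triangle S z y x (hdr (P.ht_le_join_right y z))
      (hdr (P.ht_le_join_left y z))
    rw [P.discount_comm S z y, P.discount_comm S y x, P.discount_comm S z x] at h3
    linarith
  · have h2 := radius_mono h1 h
    have h3 := P.discount_triangle S x y z (hdr (P.ht_le_join_left x y))
      (hdr (P.ht_le_join_right x y))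
    linarith

/-- The metric of a placement with the set `S` of vertices that see each other along the tree. -/
noncomputable def metric {δ : ℝ} (h0 : 0 < δ) (h1 : δ ≤ 1) (S : V → Prop)
    (hS : ∀ x y, S x → S y → P.ht x = P.ht y → P.join x y = P.ht x → x = y) : Metric V where
  w := P.dist δ S
  self u := by simp [dist]
  pos u v huv := P.dist_pos h0 h1 hS huv
  symm := P.dist_comm δ S
  triangle u v x := P.dist_triangle h0 h1 hS u v x

/-- The metric of a placement in which all paths run through leaves. -/
noncomputable def plainMetric {δ : ℝ} (h0 : 0 < δ) (h1 : δ ≤ 1) : Metric V :=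
  P.metric h0 h1 (fun _ => False) fun _ _ h => h.elim

end Placement

/-! ### Steiner trees from connected families of edges -/

lemma Metric.w_nonneg {V : Type*} (m : Metric V) (x y : V) : 0 ≤ m.w x y := by
  by_cases h : x = y
  · rw [h, m.self]
  · exact (m.pos x y h).le

lemma Metric.edgeWeight_nonneg {V : Type*} (m : Metric V) (e : Sym2 V) : 0 ≤ m.edgeWeight e := by
  induction e with
  | _ x y => exact m.w_nonneg x y

lemma Metric.weight_nonneg {V : Type*} (m : Metric V) (H : (⊤ : SimpleGraph V).Subgraph) :
    0 ≤ m.weight H :=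
  finsum_mem_induction (fun x : ℝ => 0 ≤ x) le_rfl (fun _ _ => add_nonneg)
    fun e _ => m.edgeWeight_nonneg e

/-- Directed edges that connect all terminals to a root contain a Steiner tree. -/
lemma Metric.exists_isSteinerTree_weight_le {V ι : Type*} [Finite V] (m : Metric V) (T : Finset V)
    (s : Finset ι) (f g : ι → V) (root : V)
    (hT : ∀ t ∈ T, Relation.ReflTransGen (fun a b => ∃ i ∈ s, a = f i ∧ b = g i) t root) :
    ∃ H : (⊤ : SimpleGraph V).Subgraph, IsSteinerTree T H ∧
      m.weight H ≤ ∑ i ∈ s, m.w (f i) (g i) := by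
  classical
  let G : SimpleGraph V := SimpleGraph.fromRel fun a b => ∃ i ∈ s, a = f i ∧ b = g i
  let C : Set V := {v | G.Reachable v root}
  have hreach : ∀ t, Relation.ReflTransGen (fun a b => ∃ i ∈ s, a = f i ∧ b = g i) t root →
      t ∈ C := by
    intro t ht
    induction ht using Relation.ReflTransGen.head_induction_on with
    | refl => exact SimpleGraph.Reachable.refl _
    | head hab _ ih =>
      rename_i a b _
      by_cases hne : a = b
      · rw [hne]; exact ih
      · exact SimpleGraph.Reachable.trans (SimpleGraph.Adj.reachable
          ((SimpleGraph.fromRel_adj _ _ _).2 ⟨hne, Or.inl hab⟩)) ih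
  have hconn : (G.induce C).Connected := by
    have h1 : ∀ v (hv : v ∈ C), (G.induce C).Reachable ⟨v, hv⟩
        ⟨root, SimpleGraph.Reachable.refl _⟩ := by
      rintro v ⟨p⟩
      have : ∀ {a b : V} (p : G.Walk a b) (hb : b ∈ C), ∃ ha : a ∈ C,
          (G.induce C).Reachable ⟨a, ha⟩ ⟨b, hb⟩ := by
        intro a b p
        induction p with
        | nil => exact fun hb => ⟨hb, SimpleGraph.Reachable.refl _⟩
        | cons hadj p ih =>
          intro hb
          obtain ⟨ha, hr⟩ := ih hb
          refine ⟨SimpleGraph.Reachable.trans hadj.reachable ha, ?_⟩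
          refine SimpleGraph.Reachable.trans (SimpleGraph.Adj.reachable ?_) hr
          exact hadj
      exact (this p _).2
    have : Nonempty C := ⟨⟨root, SimpleGraph.Reachable.refl _⟩⟩
    exact ⟨fun u v => (h1 u u.2).trans (h1 v v.2).symm⟩
  obtain ⟨F, hF, hFtree⟩ := hconn.exists_isTree_le
  let H : (⊤ : SimpleGraph V).Subgraph :=
    { verts := C
      Adj := fun a b => ∃ (ha : a ∈ C) (hb : b ∈ C), F.Adj ⟨a, ha⟩ ⟨b, hb⟩
      adj_sub := fun {a b} ⟨_, _, hab⟩ => by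
        rw [SimpleGraph.top_adj]
        exact fun h => hab.ne (Subtype.ext h)
      edge_vert := fun ⟨ha, _, _⟩ => ha
      symm := ⟨fun _ _ ⟨ha, hb, hab⟩ => ⟨hb, ha, hab.symm⟩⟩ }
  have hHF : H.coe = F := by
    ext a b
    exact ⟨fun ⟨_, _, h⟩ => h, fun h => ⟨a.2, b.2, h⟩⟩
  have hH : IsSteinerTree T H := ⟨hHF ▸ hFtree, fun t ht => hreach t (hT t ht)⟩
  refine ⟨H, hH, ?_⟩
  have hsub : H.edgeSet ⊆ ((s.image fun i => s(f i, g i)) : Finset (Sym2 V)) := by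
    intro e
    induction e with
    | _ a b =>
      rintro ⟨ha, hb, hab⟩
      have hG : G.Adj a b := hF hab
      have := (SimpleGraph.fromRel_adj _ _ _).1 hG
      rcases this.2 with ⟨i, hi, h1, h2⟩ | ⟨i, hi, h1, h2⟩
      · simp only [Finset.coe_image, Set.mem_image]
        exact ⟨i, hi, by rw [← h1, ← h2]⟩
      · simp only [Finset.coe_image, Set.mem_image]
        exact ⟨i, hi, by rw [← h1, ← h2, Sym2.eq_swap]⟩
  have hfin : H.edgeSet.Finite := Set.toFinite _
  calc m.weight H = ∑ e ∈ hfin.toFinset, m.edgeWeight e :=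
        finsum_mem_eq_finite_toFinset_sum _ hfin
    _ ≤ ∑ e ∈ s.image (fun i => s(f i, g i)), m.edgeWeight e :=
        Finset.sum_le_sum_of_subset_of_nonneg
          (fun e he => Finset.mem_coe.1 (hsub (hfin.mem_toFinset.1 he)))
          fun e _ _ => m.edgeWeight_nonneg e
    _ ≤ ∑ i ∈ s, m.edgeWeight s(f i, g i) :=
        Finset.sum_image_le_of_nonneg (fun e _ => m.edgeWeight_nonneg e)
    _ = ∑ i ∈ s, m.w (f i) (g i) := rfl

lemma Metric.steinerCost_le {V ι : Type*} [Finite V] (m : Metric V) (T : Finset V)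
    (s : Finset ι) (f g : ι → V) (root : V)
    (hT : ∀ t ∈ T, Relation.ReflTransGen (fun a b => ∃ i ∈ s, a = f i ∧ b = g i) t root) :
    m.steinerCost T ≤ ∑ i ∈ s, m.w (f i) (g i) := by
  obtain ⟨H, hH, hle⟩ := m.exists_isSteinerTree_weight_le T s f g root hT
  refine le_trans (csInf_le ⟨0, ?_⟩ ⟨H, hH, rfl⟩) hle
  rintro _ ⟨H, -, rfl⟩
  exact m.weight_nonneg H

lemma Metric.le_steinerCost {V : Type*} [Finite V] [Nonempty V] (m : Metric V) (T : Finset V)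
    {a : ℝ} (ha : ∀ H, IsSteinerTree T H → a ≤ m.weight H) : a ≤ m.steinerCost T := by
  classical
  obtain ⟨root⟩ := ‹Nonempty V›
  obtain ⟨H, hH, -⟩ := m.exists_isSteinerTree_weight_le T T id (fun _ => root) root
    fun t ht => Relation.ReflTransGen.single ⟨t, ht, rfl, rfl⟩
  refine le_csInf ⟨_, H, hH, rfl⟩ ?_
  rintro _ ⟨H, hH, rfl⟩
  exact ha H hH

/-! ### The Steiner cost without shortcuts -/

/-- A connected family of finite sets, in which adjacent sets intersect, covers few elements. -/
lemma card_biUnion_sub_one_le {ι α : Type*} [Fintype ι] [DecidableEq α] {G : SimpleGraph ι}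
    (hG : G.Connected) (K : ι → Finset α) (hK : ∀ x y, G.Adj x y → (K x ∩ K y).Nonempty) :
    (((Finset.univ.biUnion K).card : ℝ) - 1) ≤ ∑ x, (((K x).card : ℝ) - 1) := by
  classical
  obtain ⟨x₀⟩ := hG.nonempty
  let good : Finset (Finset ι) := Finset.univ.filter fun S => x₀ ∈ S ∧
    (((S.biUnion K).card : ℝ) - 1) ≤ ∑ x ∈ S, (((K x).card : ℝ) - 1)
  have hgood : good.Nonempty := ⟨{x₀}, by simp [good]⟩
  -- A largest vertex set with the bound is everything: a vertex across a boundary edge shares an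
  -- element with the union, so it could be added.
  obtain ⟨S, hS, hmax⟩ := good.exists_max_image Finset.card hgood
  have hS' := (Finset.mem_filter.1 hS).2
  have hSuniv : S = Finset.univ := by
    by_contra hne
    obtain ⟨z, hz⟩ : ∃ z, z ∉ S := by
      by_contra! hall
      exact hne (Finset.eq_univ_iff_forall.2 hall)
    obtain ⟨p⟩ := hG.preconnected x₀ z
    obtain ⟨d, -, hd1, hd2⟩ := p.exists_boundary_dart (S : Set ι) hS'.1 hz
    have hd2 : d.snd ∉ S := hd2
    have hmem : insert d.snd S ∈ good := by
      refine Finset.mem_filter.2 ⟨Finset.mem_univ _, Finset.mem_insert_of_mem hS'.1, ?_⟩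
      rw [Finset.sum_insert hd2, Finset.biUnion_insert]
      have h1 := Finset.card_union_add_card_inter (K d.snd) (S.biUnion K)
      have h2 : 1 ≤ (K d.snd ∩ S.biUnion K).card := by
        obtain ⟨a, ha⟩ := hK _ _ d.adj
        refine Finset.card_pos.2 ⟨a, ?_⟩
        rw [Finset.mem_inter] at ha ⊢
        exact ⟨ha.2, Finset.mem_biUnion.2 ⟨_, hd1, ha.1⟩⟩
      have h3 : ((K d.snd ∪ S.biUnion K).card : ℝ) + 1 ≤ (K d.snd).card + (S.biUnion K).card := by
        exact_mod_cast (by omega : (K d.snd ∪ S.biUnion K).card + 1 ≤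
          (K d.snd).card + (S.biUnion K).card)
      linarith [hS'.2]
    have := hmax _ hmem
    rw [Finset.card_insert_of_notMem hd2] at this
    omega
  rw [hSuniv] at hS'
  exact hS'.2

namespace Placement

variable {V : Type*} (P : Placement V)

/-- An orientation of the pairs of vertices along which the height does not decrease. -/
def Below [LinearOrder V] (y x : V) : Prop := P.ht y < P.ht x ∨ (P.ht y = P.ht x ∧ y < x)

lemma Below.ht_le [LinearOrder V] {P : Placement V} {x y : V} (h : P.Below y x) :
    P.ht y ≤ P.ht x := by
  rcases h with h | h
  · exact h.le
  · exact h.1.le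

lemma Below.asymm [LinearOrder V] {P : Placement V} {x y : V} (h : P.Below y x) :
    ¬ P.Below x y := by
  rcases h with h | h <;> rintro (h' | h')
  · omega
  · omega
  · omega
  · exact lt_asymm h.2 h'.2

lemma below_or_below [LinearOrder V] {x y : V} (h : x ≠ y) : P.Below y x ∨ P.Below x y := by
  unfold Below
  rcases lt_or_gt_of_ne h with h | h <;> rcases lt_trichotomy (P.ht x) (P.ht y) with hlt | hlt | hlt <;>
    simp [h, hlt]

/-- The length of a path from `x` to a leaf at position `p`. -/
noncomputable def leafDist (x : V) (p : ℕ) : ℝ :=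
  2 * depth (meet (P.ht x) (P.pos x) p) - depth (P.ht x)

lemma leafDist_nonneg (x : V) (p : ℕ) : 0 ≤ P.leafDist x p := by
  have h1 := depth_strictMono.monotone (le_max_left (P.ht x) (lca p (P.pos x)))
  have h2 := depth_nonneg (P.ht x)
  unfold leafDist meet
  linarith

lemma leafDist_self (x : V) : P.leafDist x (P.pos x) = depth (P.ht x) := by
  unfold leafDist meet
  rw [lca_self, Nat.max_zero]
  ring

/-- The path from `y` drops to its own leaf and continues from there to `x`. -/
lemma leafDist_add_le [LinearOrder V] {δ : ℝ} (h0 : 0 < δ) (h1 : δ ≤ 1) {x y : V}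
    (h : P.Below y x) :
    P.leafDist x (P.pos y) + depth (P.ht y) ≤ (P.plainMetric h0 h1).w x y := by
  have hne : x ≠ y := by
    rintro rfl
    exact h.asymm h
  have hle := h.ht_le
  have hj : P.join x y = meet (P.ht x) (P.pos x) (P.pos y) := by
    unfold join meet
    rw [max_eq_left hle, lca_comm]
  have h2 := depth_le_radius h0.le (P.join x y)
  have h3 := depth_strictMono.monotone hle
  simp only [plainMetric, metric, dist, hne, discount, and_self, if_false]
  rw [abs_of_nonneg (sub_nonneg.2 h3)]
  unfold leafDist
  rw [← hj]
  linarith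

variable [Fintype V] [LinearOrder V] (H : (⊤ : SimpleGraph V).Subgraph)

open Classical in
/-- The lower neighbours of a vertex in `H`. -/
noncomputable def lower (x : V) : Finset V :=
  Finset.univ.filter fun y => H.Adj x y ∧ P.Below y x

open Classical in
/-- The leaf positions that `x` joins when every edge of `H` is rerouted through a leaf below its
lower end. -/
noncomputable def joined (x : V) : Finset ℕ :=
  (P.lower H x).image P.pos ∪
    if P.ht x = 0 ∨ ∃ y, x ∈ P.lower H y then {P.pos x} else ∅

variable {H}

lemma mem_lower {x y : V} : y ∈ P.lower H x ↔ H.Adj x y ∧ P.Below y x := by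
  simp [lower]

lemma pos_mem_joined_of_mem_lower {x y : V} (h : y ∈ P.lower H x) : P.pos y ∈ P.joined H x :=
  Finset.mem_union_left _ (Finset.mem_image_of_mem _ h)

lemma pos_mem_joined_self {x : V} (h : P.ht x = 0 ∨ ∃ y, x ∈ P.lower H y) :
    P.pos x ∈ P.joined H x := by
  unfold joined
  rw [if_pos h]
  exact Finset.mem_union_right _ (Finset.mem_singleton_self _)

/-- `Below` is antisymmetric, so no edge is counted twice. -/
lemma sum_lower_le_weight (m : Metric V) :
    ∑ x, ∑ y ∈ P.lower H x, m.w x y ≤ m.weight H := by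
  classical
  have hfin : H.edgeSet.Finite := Set.toFinite _
  let f : (Σ _ : V, V) → Sym2 V := fun z => s(z.1, z.2)
  let E : Finset (Σ _ : V, V) := Finset.univ.sigma fun x => P.lower H x
  have hinj : Set.InjOn f E := by
    rintro ⟨x, y⟩ hxy ⟨x', y'⟩ hxy' he
    have h1 := ((P.mem_lower).1 (Finset.mem_sigma.1 hxy).2).2
    have h2 := ((P.mem_lower).1 (Finset.mem_sigma.1 hxy').2).2
    rcases Sym2.eq_iff.1 he with ⟨h3, h4⟩ | ⟨h3, h4⟩
    · simp only at h3 h4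
      subst h3 h4
      rfl
    · simp only at h3 h4 h1 h2
      subst h3 h4
      exact absurd h2 h1.asymm
  calc ∑ x, ∑ y ∈ P.lower H x, m.w x y = ∑ z ∈ E, m.edgeWeight (f z) := by
        rw [Finset.sum_sigma]
        rfl
    _ = ∑ e ∈ E.image f, m.edgeWeight e := (Finset.sum_image hinj).symm
    _ ≤ ∑ e ∈ hfin.toFinset, m.edgeWeight e := by
        refine Finset.sum_le_sum_of_subset_of_nonneg ?_ fun e _ _ => m.edgeWeight_nonneg e
        intro e he
        obtain ⟨⟨x, y⟩, hz, rfl⟩ := Finset.mem_image.1 he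
        exact hfin.mem_toFinset.2 ((P.mem_lower).1 (Finset.mem_sigma.1 hz).2).1
    _ = m.weight H := (finsum_mem_eq_finite_toFinset_sum _ hfin).symm

/-- Each edge pays its upper end for the leg to the leaf and its lower end for the drop. A lower end
needs one drop, even if several edges offer it; at height `0` the drop is free. -/
lemma sum_leafDist_le_weight {δ : ℝ} (h0 : 0 < δ) (h1 : δ ≤ 1) :
    ∑ x, ∑ p ∈ P.joined H x, P.leafDist x p ≤ (P.plainMetric h0 h1).weight H := by
  classical
  refine le_trans ?_ (P.sum_lower_le_weight (P.plainMetric h0 h1))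
  have hswap : ∑ x, ∑ y ∈ P.lower H x, depth (P.ht y) =
      ∑ y, ∑ x ∈ Finset.univ.filter (fun x => y ∈ P.lower H x), depth (P.ht y) :=
    Finset.sum_comm' (by simp)
  calc ∑ x, ∑ p ∈ P.joined H x, P.leafDist x p
      ≤ ∑ x, (∑ y ∈ P.lower H x, P.leafDist x (P.pos y) +
          ∑ y ∈ Finset.univ.filter (fun y => x ∈ P.lower H y), depth (P.ht x)) := by
        refine Finset.sum_le_sum fun x _ => ?_
        have hA : ∑ p ∈ (P.lower H x).image P.pos, P.leafDist x p ≤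
            ∑ y ∈ P.lower H x, P.leafDist x (P.pos y) :=
          Finset.sum_image_le_of_nonneg fun p _ => P.leafDist_nonneg x p
        have hB : ∑ p ∈ (if P.ht x = 0 ∨ ∃ y, x ∈ P.lower H y then {P.pos x} else ∅),
            P.leafDist x p ≤
              ∑ y ∈ Finset.univ.filter (fun y => x ∈ P.lower H y), depth (P.ht x) := by
          have hnn : ∀ y ∈ Finset.univ.filter (fun y => x ∈ P.lower H y), 0 ≤ depth (P.ht x) :=
            fun _ _ => depth_nonneg _
          split_ifs with hc
          · rw [Finset.sum_singleton, P.leafDist_self]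
            rcases hc with hc | ⟨y, hy⟩
            · rw [hc, depth_zero]
              simp
            · exact Finset.single_le_sum hnn (Finset.mem_filter.2 ⟨Finset.mem_univ y, hy⟩)
          · rw [Finset.sum_empty]
            exact Finset.sum_nonneg hnn
        have hC : ∑ p ∈ P.joined H x, P.leafDist x p ≤
            ∑ p ∈ (P.lower H x).image P.pos, P.leafDist x p +
            ∑ p ∈ (if P.ht x = 0 ∨ ∃ y, x ∈ P.lower H y then {P.pos x} else ∅),
              P.leafDist x p := by
          unfold joined
          rw [← Finset.sum_union_inter]
          refine le_add_of_nonneg_right (Finset.sum_nonneg fun p _ => P.leafDist_nonneg x p)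
        linarith
    _ = ∑ x, ∑ y ∈ P.lower H x, (P.leafDist x (P.pos y) + depth (P.ht y)) := by
        simp only [Finset.sum_add_distrib]
        rw [hswap]
    _ ≤ ∑ x, ∑ y ∈ P.lower H x, (P.plainMetric h0 h1).w x y :=
        Finset.sum_le_sum fun x _ => Finset.sum_le_sum fun y hy =>
          P.leafDist_add_le h0 h1 ((P.mem_lower).1 hy).2

lemma joined_nonempty (hH : H.coe.Connected) (hnt : H.verts.Nontrivial) {x : V}
    (hx : x ∈ H.verts) : (P.joined H x).Nonempty := by
  obtain ⟨z, hz, hzx⟩ := hnt.exists_ne x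
  obtain ⟨p⟩ := hH.preconnected ⟨x, hx⟩ ⟨z, hz⟩
  obtain ⟨y, hy⟩ : ∃ y, H.Adj x y := by
    cases p with
    | nil => exact absurd rfl hzx
    | cons h _ => exact ⟨_, h⟩
  rcases P.below_or_below hy.ne with h | h
  · exact ⟨_, P.pos_mem_joined_of_mem_lower ((P.mem_lower).2 ⟨hy, h⟩)⟩
  · exact ⟨_, P.pos_mem_joined_self (Or.inr ⟨y, (P.mem_lower).2 ⟨hy.symm, h⟩⟩)⟩

/-- The leaf through which an edge is rerouted belongs to the stars of both ends. -/
lemma joined_inter_nonempty {x y : V} (h : H.Adj x y) :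
    ∃ p, p ∈ P.joined H x ∧ p ∈ P.joined H y := by
  rcases P.below_or_below h.ne with h' | h'
  · have := (P.mem_lower).2 ⟨h, h'⟩
    exact ⟨P.pos y, P.pos_mem_joined_of_mem_lower this, P.pos_mem_joined_self (Or.inr ⟨x, this⟩)⟩
  · have := (P.mem_lower).2 ⟨h.symm, h'⟩
    exact ⟨P.pos x, P.pos_mem_joined_self (Or.inr ⟨y, this⟩), P.pos_mem_joined_of_mem_lower this⟩

/-- At every level the stars have to connect all clusters. -/
lemma two_pow_sub_one_le_sum [Fintype H.verts] (hH : H.coe.Connected) {h l : ℕ} (hl : l ≤ h)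
    (hT : ∀ p < 2 ^ h, ∃ t ∈ H.verts, P.ht t = 0 ∧ P.pos t = p) :
    (2 : ℝ) ^ (h - l) - 1 ≤
      ∑ x : H.verts, (((clusters l (P.joined H (x : V))).card : ℝ) - 1) := by
  classical
  refine le_trans ?_ (card_biUnion_sub_one_le hH (fun x => clusters l (P.joined H (x : V))) ?_)
  · refine sub_le_sub_right ?_ 1
    have hsub : Finset.range (2 ^ (h - l)) ⊆
        Finset.univ.biUnion fun x : H.verts => clusters l (P.joined H (x : V)) := by
      intro a ha
      have ha := Finset.mem_range.1 ha
      -- The leftmost leaf of cluster `a`.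
      obtain ⟨t, ht, hht, hpos⟩ := hT (a * 2 ^ l) (by
        calc a * 2 ^ l < 2 ^ (h - l) * 2 ^ l := by gcongr
          _ = 2 ^ h := by rw [← pow_add, Nat.sub_add_cancel hl])
      refine Finset.mem_biUnion.2 ⟨⟨t, ht⟩, Finset.mem_univ _, Finset.mem_image.2
        ⟨P.pos t, P.pos_mem_joined_self (Or.inl hht), ?_⟩⟩
      rw [hpos, Nat.mul_div_cancel _ (by positivity)]
    have := Finset.card_le_card hsub
    rw [Finset.card_range] at this
    exact_mod_cast this
  · intro x y hxy
    obtain ⟨p, hp, hpy⟩ := P.joined_inter_nonempty (H := H) (x := x) (y := y) hxy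
    exact ⟨p / 2 ^ l, Finset.mem_inter.2
      ⟨Finset.mem_image_of_mem _ hp, Finset.mem_image_of_mem _ hpy⟩⟩

/-- The Steiner cost of a placement in which all paths run through leaves. -/
theorem le_steinerCost_plainMetric {δ : ℝ} (h0 : 0 < δ) (h1 : δ ≤ 1) {h : ℕ} (hh : 1 ≤ h)
    (T : Finset V) (hT0 : ∀ t ∈ T, P.ht t = 0) (hT : ∀ p < 2 ^ h, ∃ t ∈ T, P.pos t = p) :
    5 * 2 ^ h - 2 * (Nat.fib (h + 4) : ℝ) + Nat.fib (h + 2) ≤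
      (P.plainMetric h0 h1).steinerCost T := by
  classical
  have h2 : 1 < 2 ^ h := Nat.one_lt_two_pow (by omega)
  obtain ⟨t₀, ht₀, hp₀⟩ := hT 0 (by omega)
  obtain ⟨t₁, ht₁, hp₁⟩ := hT 1 h2
  have : Nonempty V := ⟨t₀⟩
  refine Metric.le_steinerCost _ _ fun H hH => ?_
  have hconn : H.coe.Connected := hH.1.connected
  have hnt : H.verts.Nontrivial := by
    refine ⟨t₀, hH.2 ht₀, t₁, hH.2 ht₁, ?_⟩
    rintro rfl
    omega
  rw [← sum_price_diff_mul]
  calc ∑ l ∈ Finset.range h, (price (l + 1) - price l) * ((2 : ℝ) ^ (h - l) - 1)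
      ≤ ∑ l ∈ Finset.range h, (price (l + 1) - price l) *
          ∑ x : H.verts, (((clusters l (P.joined H (x : V))).card : ℝ) - 1) := by
        refine Finset.sum_le_sum fun l hl => mul_le_mul_of_nonneg_left ?_ (price_diff_nonneg l)
        refine P.two_pow_sub_one_le_sum hconn (Finset.mem_range.1 hl).le fun p hp => ?_
        obtain ⟨t, ht, hpt⟩ := hT p hp
        exact ⟨t, hH.2 ht, hT0 t ht, hpt⟩
    _ = ∑ x : H.verts, mergePrice h (P.joined H (x : V)) := by
        simp only [Finset.mul_sum, mergePrice]
        exact Finset.sum_comm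
    _ ≤ ∑ x : H.verts, ∑ p ∈ P.joined H (x : V), P.leafDist (x : V) p :=
        Finset.sum_le_sum fun x _ => mergePrice_le_star h _ _ (P.joined_nonempty hconn hnt x.2)
    _ = ∑ x ∈ Finset.univ.filter (· ∈ H.verts), ∑ p ∈ P.joined H x, P.leafDist x p :=
        (Finset.sum_subtype (p := (· ∈ H.verts)) _ (by simp)
          fun x => ∑ p ∈ P.joined H x, P.leafDist x p).symm
    _ ≤ ∑ x, ∑ p ∈ P.joined H x, P.leafDist x p :=
        Finset.sum_le_sum_of_subset_of_nonneg (Finset.filter_subset _ _)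
          fun x _ _ => Finset.sum_nonneg fun p _ => P.leafDist_nonneg x p
    _ ≤ _ := P.sum_leafDist_le_weight h0 h1

end Placement

/-! ### Query algorithms and families of similar instances -/

/-- The pairs that the decision tree queries when the queries are answered by `m`. -/
def QueryTree.queried {V : Type*} (m : Metric V) : QueryTree V → List (V × V)
  | .output _ => []
  | .query u v next => (u, v) :: (next (m.w u v)).queried m

lemma QueryTree.length_queried {V : Type*} (m : Metric V) (Q : QueryTree V) :
    (Q.queried m).length = Q.numQueries m := by
  induction Q with
  | output x => rfl
  | query u v next ih => simp [queried, numQueries, ih]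

/-- Two runs coincide until a query receives different answers. -/
lemma QueryTree.exists_queried_of_eval_ne {V : Type*} {m m' : Metric V} {Q : QueryTree V}
    (h : Q.eval m ≠ Q.eval m') : ∃ z ∈ Q.queried m, m'.w z.1 z.2 ≠ m.w z.1 z.2 := by
  induction Q with
  | output x => exact absurd rfl h
  | query u v next ih =>
    by_cases he : m'.w u v = m.w u v
    · simp only [eval, he] at h
      obtain ⟨z, hz, hne⟩ := ih _ h
      exact ⟨z, List.mem_cons_of_mem _ hz, hne⟩
    · exact ⟨(u, v), List.mem_cons_self, he⟩

open MeasureTheory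

/-- If an algorithm has to tell an instance from each member of a family of instances, and each
query reveals at most a fraction `1 / q` of the family, then it needs `q / 50` queries. -/
theorem RandomizedAlgorithm.le_expectedQueries {V Ω R : Type*} [MeasurableSpace Ω] [Fintype R]
    [Nonempty R] (A : RandomizedAlgorithm V Ω) (μ : Measure Ω) [IsProbabilityMeasure μ]
    {k q : ℕ} {α : ℝ} (hA : A.Estimates μ k α (51 / 100)) {T : Finset V} (hT : T.card = k)
    (m₀ : Metric V) (m : R → Metric V) (hcost : ∀ r, α * (m r).steinerCost T < m₀.steinerCost T)
    (hq : ∀ u v, Nat.card {r // (m r).w u v ≠ m₀.w u v} * q ≤ Fintype.card R) :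
    ENNReal.ofReal (q / 50) ≤ A.expectedQueries μ T m₀ := by
  classical
  set a := m₀.steinerCost T with ha
  let F : R → Set Ω := fun r => {ω | a ≤ (A.run T ω).eval m₀} ∩ {ω | (A.run T ω).eval (m r) < a}
  have hm1 : MeasurableSet {ω | a ≤ (A.run T ω).eval m₀} :=
    measurableSet_le measurable_const (A.measurable_eval T m₀)
  have hm2 : ∀ r, MeasurableSet {ω | (A.run T ω).eval (m r) < a} := fun r =>
    measurableSet_lt (A.measurable_eval T (m r)) measurable_const
  have hF : ∀ r, MeasurableSet (F r) := fun r => hm1.inter (hm2 r)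
  -- Two events of probability at least `0.51` overlap with probability at least `0.02`.
  have hprob : ∀ r, ENNReal.ofReal (1 / 50) ≤ μ (F r) := by
    intro r
    have h1 : 51 / 100 ≤ μ.real {ω | a ≤ (A.run T ω).eval m₀} :=
      (hA T m₀ hT).trans (measureReal_mono fun ω hω => hω.1)
    have h2 : 51 / 100 ≤ μ.real {ω | (A.run T ω).eval (m r) < a} :=
      (hA T (m r) hT).trans (measureReal_mono fun ω hω => hω.2.trans_lt (hcost r))
    have h3 := measureReal_union_add_inter (μ := μ) (s := {ω | a ≤ (A.run T ω).eval m₀}) (hm2 r)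
    have h4 : μ.real ({ω | a ≤ (A.run T ω).eval m₀} ∪ {ω | (A.run T ω).eval (m r) < a}) ≤ 1 :=
      measureReal_le_one
    refine ENNReal.ofReal_le_of_le_toReal ?_
    change 1 / 50 ≤ μ.real (F r)
    linarith
  have hpoint : ∀ ω, q * (Finset.univ.filter fun r => ω ∈ F r).card ≤
      Fintype.card R * (A.run T ω).numQueries m₀ := by
    intro ω
    set L := ((A.run T ω).queried m₀).toFinset with hL
    have hsub : (Finset.univ.filter fun r => ω ∈ F r) ⊆
        L.biUnion fun z => Finset.univ.filter fun r => (m r).w z.1 z.2 ≠ m₀.w z.1 z.2 := by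
      intro r hr
      obtain ⟨h1, h2⟩ := (Finset.mem_filter.1 hr).2
      obtain ⟨z, hz, hne⟩ := QueryTree.exists_queried_of_eval_ne
        (m := m₀) (m' := m r) (Q := A.run T ω) (lt_of_lt_of_le h2 h1).ne'
      exact Finset.mem_biUnion.2 ⟨z, List.mem_toFinset.2 hz, by simpa using hne⟩
    calc q * (Finset.univ.filter fun r => ω ∈ F r).card
        ≤ q * ∑ z ∈ L, (Finset.univ.filter fun r => (m r).w z.1 z.2 ≠ m₀.w z.1 z.2).card :=
          Nat.mul_le_mul_left _ ((Finset.card_le_card hsub).trans Finset.card_biUnion_le)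
      _ ≤ ∑ z ∈ L, Fintype.card R := by
          rw [Finset.mul_sum]
          refine Finset.sum_le_sum fun z _ => ?_
          have := hq z.1 z.2
          rw [Nat.card_eq_fintype_card, Fintype.card_subtype] at this
          rwa [mul_comm]
      _ = Fintype.card R * L.card := by rw [Finset.sum_const, smul_eq_mul, mul_comm]
      _ ≤ Fintype.card R * (A.run T ω).numQueries m₀ := by
          rw [← QueryTree.length_queried]
          exact Nat.mul_le_mul_left _ (List.toFinset_card_le _)
  have hR0 : (Fintype.card R : ENNReal) ≠ 0 := by
    exact_mod_cast Fintype.card_ne_zero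
  have hmain : (Fintype.card R : ENNReal) * ENNReal.ofReal (q / 50) ≤
      Fintype.card R * A.expectedQueries μ T m₀ := by
    calc (Fintype.card R : ENNReal) * ENNReal.ofReal (q / 50)
        = q * ∑ _r : R, ENNReal.ofReal (1 / 50) := by
          rw [Finset.sum_const, Finset.card_univ, nsmul_eq_mul, div_eq_mul_one_div,
            ENNReal.ofReal_mul (Nat.cast_nonneg q), ENNReal.ofReal_natCast]
          ring
      _ ≤ q * ∑ r, μ (F r) := by gcongr with r; exact hprob r
      _ = ∫⁻ ω, q * ∑ r, (F r).indicator 1 ω ∂μ := by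
          rw [lintegral_const_mul _ (Finset.measurable_sum _ fun r _ =>
            measurable_one.indicator (hF r)),
            lintegral_finsetSum _ fun r _ => measurable_one.indicator (hF r)]
          simp only [lintegral_indicator_one (hF _)]
      _ ≤ ∫⁻ ω, Fintype.card R * ((A.run T ω).numQueries m₀ : ENNReal) ∂μ := by
          refine lintegral_mono fun ω => ?_
          have : ∑ r, (F r).indicator (1 : Ω → ENNReal) ω =
              ((Finset.univ.filter fun r => ω ∈ F r).card : ENNReal) := by
            simp only [Set.indicator_apply, Pi.one_apply]
            rw [Finset.sum_boole]
          rw [this]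
          rw [← Nat.cast_mul, ← Nat.cast_mul]
          exact Nat.cast_le.2 (hpoint ω)
      _ = Fintype.card R * A.expectedQueries μ T m₀ :=
          lintegral_const_mul' _ _ (ENNReal.natCast_ne_top _)
  exact (ENNReal.mul_le_mul_iff_right hR0 (ENNReal.natCast_ne_top _)).1 hmain

/-- Fixing two values of a function leaves at most a fraction `1 / s ^ 2` of all functions. -/
lemma card_two_values_mul_le {M s : ℕ} {i j : Fin M} (hij : i ≠ j) (S : Set (Fin M → Fin s))
    (hS : ∀ r ∈ S, ∀ r' ∈ S, r i = r' i ∧ r j = r' j) :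
    Nat.card S * s ^ 2 ≤ Fintype.card (Fin M → Fin s) := by
  classical
  let f : S × (Fin s × Fin s) → (Fin M → Fin s) := fun z =>
    Function.update (Function.update z.1 i z.2.1) j z.2.2
  have hf : Function.Injective f := by
    rintro ⟨⟨r, hr⟩, b, c⟩ ⟨⟨r', hr'⟩, b', c'⟩ h
    have hc : c = c' := by simpa [f] using congrFun h j
    have hb : b = b' := by simpa [f, hij] using congrFun h i
    have hrr : r = r' := by
      funext x
      obtain ⟨h1, h2⟩ := hS r hr r' hr'
      by_cases hxj : x = j
      · rw [hxj, h2]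
      by_cases hxi : x = i
      · rw [hxi, h1]
      simpa [f, hxi, hxj] using congrFun h x
    subst hc hb hrr
    rfl
  have := Nat.card_le_card_of_injective f hf
  rw [Nat.card_prod, Nat.card_prod, Nat.card_fin, ← sq] at this
  rwa [← Nat.card_eq_fintype_card]

/-! ### The hard instances -/

/-- The placement of `Fin n`: the first `k` vertices are terminals, one at each of the `2 ^ h` leaves
and the others at leaf `0`. The remaining vertices are distributed cyclically to `h * 2 ^ h` groups,
and all vertices of group `g` sit at height `1 + g / 2 ^ h` above the leaf `g % 2 ^ h`. -/
def placement (n k h : ℕ) : Placement (Fin n) where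
  pos v := if (v : ℕ) < k then (if (v : ℕ) < 2 ^ h then v else 0)
    else (v - k) % (h * 2 ^ h) % 2 ^ h
  ht v := if (v : ℕ) < k then 0 else 1 + (v - k) % (h * 2 ^ h) / 2 ^ h

/-- The vertex number `ρ g` of every group `g` at the leftmost leaf below its node. -/
def Chosen (n k h : ℕ) (ρ : ℕ → ℕ) (v : Fin n) : Prop :=
  ∃ g < h * 2 ^ h, (v : ℕ) = k + h * 2 ^ h * ρ g + g ∧ 2 ^ (1 + g / 2 ^ h) ∣ g % 2 ^ h

lemma placement_of_eq {n k h g a : ℕ} (hg : g < h * 2 ^ h) {v : Fin n}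
    (hv : (v : ℕ) = k + h * 2 ^ h * a + g) :
    (placement n k h).pos v = g % 2 ^ h ∧ (placement n k h).ht v = 1 + g / 2 ^ h := by
  have h1 : ¬ (v : ℕ) < k := by rw [hv]; omega
  have h2 : (v - k : ℕ) % (h * 2 ^ h) = g := by
    rw [hv, add_assoc, Nat.add_sub_cancel_left, Nat.mul_add_mod, Nat.mod_eq_of_lt hg]
  simp only [placement, if_neg h1, h2, and_self]

/-- Several groups share a tree node; requiring the leftmost leaf leaves one group per node, from
which `ρ` selects one vertex. -/
lemma Chosen.eq_of_join {n k h : ℕ} {ρ : ℕ → ℕ} (x y : Fin n) (hx : Chosen n k h ρ x)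
    (hy : Chosen n k h ρ y) (hht : (placement n k h).ht x = (placement n k h).ht y)
    (hj : (placement n k h).join x y = (placement n k h).ht x) : x = y := by
  obtain ⟨g, hg, hv, hd⟩ := hx
  obtain ⟨g', hg', hv', hd'⟩ := hy
  obtain ⟨hp, hh⟩ := placement_of_eq hg hv
  obtain ⟨hp', hh'⟩ := placement_of_eq hg' hv'
  have hl : lca (g % 2 ^ h) (g' % 2 ^ h) ≤ 1 + g / 2 ^ h := by
    rw [← hp, ← hp', ← hh, ← hj]
    exact le_max_right _ _
  rw [hh, hh'] at hht
  have hdiv : g / 2 ^ h = g' / 2 ^ h := by omega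
  have hmod : g % 2 ^ h = g' % 2 ^ h := by
    have := lca_le_iff.1 hl
    rw [← hdiv] at hd'
    rw [← Nat.div_mul_cancel hd, this, Nat.div_mul_cancel hd']
  have hgg : g = g' := by rw [← Nat.div_add_mod g (2 ^ h), hdiv, hmod, Nat.div_add_mod]
  subst hgg
  exact (Fin.ext (hv'.trans hv.symm)).symm

/-- The instance in which the chosen vertices see each other along the tree. -/
noncomputable def shortcutMetric (n k h : ℕ) {δ : ℝ} (h0 : 0 < δ) (h1 : δ ≤ 1) (ρ : ℕ → ℕ) :
    Metric (Fin n) :=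
  (placement n k h).metric h0 h1 (Chosen n k h ρ) Chosen.eq_of_join

/-- The terminals of the hard instances. -/
def terminals (n k : ℕ) : Finset (Fin n) := Finset.univ.filter fun v => (v : ℕ) < k

lemma card_terminals {n k : ℕ} (hk : k ≤ n) : (terminals n k).card = k := by
  unfold terminals
  rw [Fin.card_filter_val_lt, min_eq_right hk]

lemma chosen_of_ne {n k h : ℕ} {δ : ℝ} (h0 : 0 < δ) (h1 : δ ≤ 1) {ρ : ℕ → ℕ} {u v : Fin n}
    (hne : (shortcutMetric n k h h0 h1 ρ).w u v ≠ ((placement n k h).plainMetric h0 h1).w u v) :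
    u ≠ v ∧ Chosen n k h ρ u ∧ Chosen n k h ρ v := by
  by_contra hc
  apply hne
  simp only [shortcutMetric, Placement.plainMetric, Placement.metric, Placement.dist,
    Placement.discount, and_self, if_false]
  by_cases huv : u = v
  · simp [huv]
  · have : ¬ (Chosen n k h ρ u ∧ Chosen n k h ρ v) := fun h => hc ⟨huv, h⟩
    simp [huv, this]

/-- The number of the chosen vertex at height `j` above the leaf `p`, and the terminal at this leaf
for `j = 0`. -/
def nodeIndex (k h : ℕ) (ρ : ℕ → ℕ) (j p : ℕ) : ℕ :=
  if j = 0 then p else k + h * 2 ^ h * ρ ((j - 1) * 2 ^ h + p) + ((j - 1) * 2 ^ h + p)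

lemma group_lt {h j p : ℕ} (hj : j ≠ 0) (hjh : j ≤ h) (hp : p < 2 ^ h) :
    (j - 1) * 2 ^ h + p < h * 2 ^ h := by
  calc (j - 1) * 2 ^ h + p < (j - 1) * 2 ^ h + 2 ^ h := by omega
    _ = (j - 1 + 1) * 2 ^ h := by ring
    _ ≤ h * 2 ^ h := Nat.mul_le_mul_right _ (by omega)

section node

variable {n k h s : ℕ} {ρ : ℕ → ℕ}

lemma nodeIndex_lt (hk : 2 ^ h ≤ k) (hn : k + h * 2 ^ h * s ≤ n) (hρ : ∀ g < h * 2 ^ h, ρ g < s)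
    {j p : ℕ} (hjh : j ≤ h) (hp : p < 2 ^ h) : nodeIndex k h ρ j p < n := by
  unfold nodeIndex
  split_ifs with hj
  · have := Nat.zero_le (h * 2 ^ h * s)
    omega
  · have hg := group_lt hj hjh hp
    have h1 : h * 2 ^ h * (ρ ((j - 1) * 2 ^ h + p) + 1) ≤ h * 2 ^ h * s :=
      Nat.mul_le_mul_left _ (hρ _ hg)
    rw [mul_add, mul_one] at h1
    omega

lemma placement_node (hk : 2 ^ h ≤ k) {j p : ℕ} (hjh : j ≤ h) (hp : p < 2 ^ h) {v : Fin n}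
    (hv : (v : ℕ) = nodeIndex k h ρ j p) :
    (placement n k h).pos v = p ∧ (placement n k h).ht v = j := by
  unfold nodeIndex at hv
  split_ifs at hv with hj
  · have h1 : (v : ℕ) < k := by omega
    have h2 : (v : ℕ) < 2 ^ h := by omega
    simp only [placement, if_pos h1, if_pos h2]
    exact ⟨hv, hj.symm⟩
  · obtain ⟨h1, h2⟩ := placement_of_eq (group_lt hj hjh hp) hv
    rw [h1, h2, Nat.mul_add_mod_self_right, Nat.mod_eq_of_lt hp, mul_comm (j - 1),
      Nat.mul_add_div (by positivity), Nat.div_eq_of_lt hp]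
    exact ⟨rfl, by omega⟩

lemma chosen_node {j p : ℕ} (hj : j ≠ 0) (hjh : j ≤ h) (hp : p < 2 ^ h) (hd : 2 ^ j ∣ p)
    {v : Fin n} (hv : (v : ℕ) = nodeIndex k h ρ j p) : Chosen n k h ρ v := by
  refine ⟨_, group_lt hj hjh hp, ?_, ?_⟩
  · rw [hv, nodeIndex, if_neg hj]
  · rw [Nat.mul_add_mod_self_right, Nat.mod_eq_of_lt hp, mul_comm (j - 1),
      Nat.mul_add_div (by positivity), Nat.div_eq_of_lt hp]
    convert hd using 2
    omega

lemma mul_two_pow_lt {c j : ℕ} (hj : j ≤ h) (hc : c < 2 ^ (h - j)) : c * 2 ^ j < 2 ^ h := by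
  calc c * 2 ^ j < 2 ^ (h - j) * 2 ^ j := by gcongr
    _ = 2 ^ h := by rw [← pow_add, Nat.sub_add_cancel hj]

lemma half_lt {c j : ℕ} (hj : j < h) (hc : c < 2 ^ (h - j)) : c / 2 < 2 ^ (h - (j + 1)) := by
  have : 2 ^ (h - j) = 2 ^ (h - (j + 1)) * 2 := by
    rw [← pow_succ]
    congr 1
    omega
  omega

/-- The distance between a chosen vertex and its parent. -/
lemma shortcutMetric_parent_le {δ : ℝ} (h0 : 0 < δ) (h1 : δ ≤ 1) (hk : 2 ^ h ≤ k) {j c : ℕ}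
    (hj : j < h) (hc : c < 2 ^ (h - j)) {u v : Fin n}
    (hu : (u : ℕ) = nodeIndex k h ρ j (c * 2 ^ j))
    (hv : (v : ℕ) = nodeIndex k h ρ (j + 1) (c / 2 * 2 ^ (j + 1))) :
    (shortcutMetric n k h h0 h1 ρ).w u v ≤ depth (j + 1) - depth j := by
  have hpu := mul_two_pow_lt hj.le hc
  have hpv : c / 2 * 2 ^ (j + 1) < 2 ^ h := mul_two_pow_lt hj (half_lt hj hc)
  obtain ⟨hu1, hu2⟩ := placement_node hk hj.le hpu hu
  obtain ⟨hv1, hv2⟩ := placement_node (j := j + 1) hk hj hpv hv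
  have hd := depth_add_one_le j
  have hl : lca (c * 2 ^ j) (c / 2 * 2 ^ (j + 1)) ≤ j + 1 := by
    rw [lca_le_iff, Nat.mul_div_cancel _ (by positivity), pow_succ, ← Nat.div_div_eq_div_mul,
      Nat.mul_div_cancel _ (by positivity)]
  have hjoin : (placement n k h).join u v = j + 1 := by
    unfold Placement.join
    rw [hu1, hu2, hv1, hv2]
    omega
  have hdisc : (placement n k h).discount (Chosen n k h ρ) u v = depth j + depth (j + 1) := by
    unfold Placement.discount
    rw [hu2, hv2]
    have hcv : Chosen n k h ρ v :=
      chosen_node j.succ_ne_zero hj hpv (Dvd.intro_left _ rfl) hv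
    split_ifs with hs
    · rfl
    -- A terminal is not chosen, but as `depth 0 = 0` both forms of the discount agree.
    · have hj0 : j = 0 := by
        by_contra hj0
        exact hs ⟨chosen_node hj0 hj.le hpu (Dvd.intro_left _ rfl) hu, hcv⟩
      rw [hj0, depth_zero, zero_sub, abs_neg, abs_of_nonneg (depth_nonneg _), zero_add (depth _)]
  simp only [shortcutMetric, Placement.metric, Placement.dist]
  split_ifs
  · linarith
  · rw [hjoin, hdisc, radius_of_pos δ j.succ_ne_zero]
    linarith

/-- The distance between a terminal without a leaf of its own and the terminal at leaf `0`. -/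
lemma shortcutMetric_extra_le {δ : ℝ} (h0 : 0 < δ) (h1 : δ ≤ 1) {u v : Fin n}
    (hu : 2 ^ h ≤ (u : ℕ)) (huk : (u : ℕ) < k) (hv : (v : ℕ) = 0) :
    (shortcutMetric n k h h0 h1 ρ).w u v ≤ 2 * δ := by
  have hjoin : (placement n k h).join u v = 0 := by
    have h2 : ¬ (u : ℕ) < 2 ^ h := not_lt.2 hu
    have h3 : 0 < k := by omega
    simp [Placement.join, placement, huk, h2, hv, h3, lca_self]
  have hdisc : 0 ≤ (placement n k h).discount (Chosen n k h ρ) u v := by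
    unfold Placement.discount
    split_ifs
    · exact add_nonneg (depth_nonneg _) (depth_nonneg _)
    · exact abs_nonneg _
  simp only [shortcutMetric, Placement.metric, Placement.dist]
  split_ifs
  · linarith
  · rw [hjoin, radius, if_pos rfl]
    linarith

/-- The Steiner cost with shortcuts. -/
theorem steinerCost_shortcutMetric_le {δ : ℝ} (h0 : 0 < δ) (h1 : δ ≤ 1) (hk : 2 ^ h ≤ k)
    (hn : k + h * 2 ^ h * s ≤ n) (hρ : ∀ g < h * 2 ^ h, ρ g < s) :
    (shortcutMetric n k h h0 h1 ρ).steinerCost (terminals n k) ≤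
      ∑ j ∈ Finset.range h, (2 : ℝ) ^ (h - j) * (depth (j + 1) - depth j) + k * (2 * δ) := by
  have hkn : k ≤ n := by have := Nat.zero_le (h * 2 ^ h * s); omega
  have h2 : 0 < 2 ^ h := by positivity
  have hn0 : n ≠ 0 := by omega
  have : NeZero n := ⟨hn0⟩
  let node : ℕ → ℕ → Fin n := fun j p => Fin.ofNat n (nodeIndex k h ρ j p)
  have hnode : ∀ j p, j ≤ h → p < 2 ^ h → ((node j p : Fin n) : ℕ) = nodeIndex k h ρ j p :=
    fun j p hj hp => Nat.mod_eq_of_lt (nodeIndex_lt hk hn hρ hj hp)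
  have hofNat : ∀ v < n, ((Fin.ofNat n v : Fin n) : ℕ) = v := fun v hv => Nat.mod_eq_of_lt hv
  -- Tree edges from each node to its parent, and one edge from each surplus terminal to leaf `0`.
  let E : Finset ((Σ _ : ℕ, ℕ) ⊕ ℕ) :=
    ((Finset.range h).sigma fun j => Finset.range (2 ^ (h - j))).disjSum (Finset.Ico (2 ^ h) k)
  let f : (Σ _ : ℕ, ℕ) ⊕ ℕ → Fin n :=
    Sum.elim (fun z => node z.1 (z.2 * 2 ^ z.1)) fun v => Fin.ofNat n v
  let g : (Σ _ : ℕ, ℕ) ⊕ ℕ → Fin n :=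
    Sum.elim (fun z => node (z.1 + 1) (z.2 / 2 * 2 ^ (z.1 + 1))) fun _ => node 0 0
  have hup : ∀ d j c, j + d = h → c < 2 ^ (h - j) →
      Relation.ReflTransGen (fun a b => ∃ i ∈ E, a = f i ∧ b = g i) (node j (c * 2 ^ j))
        (node h 0) := by
    intro d
    induction d with
    | zero =>
      intro j c hj hc
      obtain rfl : j = h := by omega
      rw [Nat.sub_self, pow_zero] at hc
      obtain rfl : c = 0 := by omega
      rw [zero_mul]
    | succ d ih =>
      intro j c hj hc
      refine Relation.ReflTransGen.head ⟨Sum.inl ⟨j, c⟩, ?_, rfl, rfl⟩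
        (ih (j + 1) (c / 2) (by omega) (half_lt (by omega) hc))
      exact Finset.inl_mem_disjSum.2 (Finset.mem_sigma.2
        ⟨Finset.mem_range.2 (show j < h by omega), Finset.mem_range.2 hc⟩)
  have hleaf : ∀ p < 2 ^ h,
      Relation.ReflTransGen (fun a b => ∃ i ∈ E, a = f i ∧ b = g i) (node 0 p) (node h 0) := by
    intro p hp
    have := hup h 0 p (by omega) (by simpa using hp)
    simpa using this
  refine (Metric.steinerCost_le _ _ E f g (node h 0) ?_).trans ?_
  · intro t ht
    have ht : (t : ℕ) < k := (Finset.mem_filter.1 ht).2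
    by_cases hlt : (t : ℕ) < 2 ^ h
    · have : t = node 0 t := Fin.ext (by rw [hnode 0 t (by omega) hlt]; rfl)
      rw [this]
      exact hleaf _ hlt
    · refine Relation.ReflTransGen.head ⟨Sum.inr t, ?_, ?_, rfl⟩ (hleaf 0 h2)
      · exact Finset.inr_mem_disjSum.2 (Finset.mem_Ico.2 ⟨not_lt.1 hlt, ht⟩)
      · exact Fin.ext (hofNat t t.2).symm
  · rw [Finset.sum_disjSum, Finset.sum_sigma]
    refine add_le_add (Finset.sum_le_sum fun j hj => ?_) ?_
    · have hj := Finset.mem_range.1 hj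
      refine (Finset.sum_le_card_nsmul _ _ (depth (j + 1) - depth j) fun c hc => ?_).trans ?_
      · have hc := Finset.mem_range.1 hc
        exact shortcutMetric_parent_le h0 h1 hk hj hc
          (hnode _ _ hj.le (mul_two_pow_lt hj.le hc))
          (hnode _ _ hj (mul_two_pow_lt hj (half_lt hj hc)))
      · rw [Finset.card_range, nsmul_eq_mul]
        push_cast
        exact le_rfl
    · refine (Finset.sum_le_card_nsmul _ _ (2 * δ) fun v hv => ?_).trans ?_
      · have hv := Finset.mem_Ico.1 hv
        have hvn := hofNat v (by omega)
        refine shortcutMetric_extra_le h0 h1 ?_ ?_ (hnode 0 0 (by omega) h2)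
        · exact hv.1.trans hvn.ge
        · exact hvn.le.trans_lt hv.2
      · rw [Nat.card_Ico, nsmul_eq_mul]
        refine mul_le_mul_of_nonneg_right ?_ (by linarith)
        exact_mod_cast Nat.sub_le _ _

end node

/-- Each pair of vertices is chosen by a small fraction of all choices. -/
lemma card_choices_mul_le {n k h s : ℕ} {δ : ℝ} (h0 : 0 < δ) (h1 : δ ≤ 1) (u v : Fin n)
    (ρ : (Fin (h * 2 ^ h) → Fin s) → ℕ → ℕ) (hρ : ∀ r (g : Fin (h * 2 ^ h)), ρ r g = r g) :
    Nat.card {r // (shortcutMetric n k h h0 h1 (ρ r)).w u v ≠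
      ((placement n k h).plainMetric h0 h1).w u v} * s ^ 2 ≤
        Fintype.card (Fin (h * 2 ^ h) → Fin s) := by
  set S : Set (Fin (h * 2 ^ h) → Fin s) := {r | (shortcutMetric n k h h0 h1 (ρ r)).w u v ≠
      ((placement n k h).plainMetric h0 h1).w u v} with hS
  rcases S.eq_empty_or_nonempty with hE | ⟨r₀, hr₀⟩
  · change Nat.card S * s ^ 2 ≤ _
    rw [hE]
    simp
  -- The group and the number of a vertex are determined by its index.
  have key : ∀ {x g g' a a' : ℕ}, g < h * 2 ^ h → g' < h * 2 ^ h → x = k + h * 2 ^ h * a + g →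
      x = k + h * 2 ^ h * a' + g' → g = g' ∧ a = a' := by
    intro x g g' a a' hg hg' hx hx'
    have he : h * 2 ^ h * a + g = h * 2 ^ h * a' + g' := by omega
    have h3 := congrArg (· % (h * 2 ^ h)) he
    have h4 := congrArg (· / (h * 2 ^ h)) he
    simp only [Nat.mul_add_mod, Nat.mod_eq_of_lt hg, Nat.mod_eq_of_lt hg',
      Nat.mul_add_div (show 0 < h * 2 ^ h by omega), Nat.div_eq_of_lt hg,
      Nat.div_eq_of_lt hg', add_zero] at h3 h4
    exact ⟨h3, h4⟩
  obtain ⟨huv, ⟨g, hg, hu, -⟩, ⟨g', hg', hv, -⟩⟩ := chosen_of_ne h0 h1 hr₀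
  refine card_two_values_mul_le (i := ⟨g, hg⟩) (j := ⟨g', hg'⟩) ?_ S ?_
  · intro he
    have he : g = g' := congrArg Fin.val he
    subst he
    exact huv (Fin.ext (hu.trans hv.symm))
  · have hval : ∀ r ∈ S, ρ r g = ρ r₀ g ∧ ρ r g' = ρ r₀ g' := by
      intro r hr
      obtain ⟨-, ⟨b, hb, hbu, -⟩, ⟨b', hb', hbv, -⟩⟩ := chosen_of_ne h0 h1 hr
      obtain ⟨rfl, e1⟩ := key hg hb hu hbu
      obtain ⟨rfl, e2⟩ := key hg' hb' hv hbv
      exact ⟨e1.symm, e2.symm⟩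
    intro r hr r' hr'
    have e1 := hval r hr
    have e2 := hval r' hr'
    have f1 := hρ r ⟨g, hg⟩
    have f2 := hρ r ⟨g', hg'⟩
    have f3 := hρ r' ⟨g, hg⟩
    have f4 := hρ r' ⟨g', hg'⟩
    simp only at f1 f2 f3 f4
    exact ⟨Fin.ext (by omega), Fin.ext (by omega)⟩

/-! ### The choice of the parameters -/

lemma fib_add_two_le (m : ℕ) : Nat.fib (m + 2) ≤ 2 * Nat.fib (m + 1) := by
  have := Nat.fib_mono (Nat.le_succ m)
  rw [Nat.fib_add_two, two_mul]
  exact Nat.add_le_add_right this _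

/-- Per step `h` grows by a factor of at most `6 / 5` and the Fibonacci number by at most `5 / 3`,
together at most `2`. -/
lemma four_mul_fib_le {h : ℕ} (hh : 24 ≤ h) : 4 * h * Nat.fib (h + 2) ≤ 2 ^ h := by
  induction h, hh using Nat.le_induction with
  | base => norm_num
  | succ h hh ih =>
    have f2 := Nat.fib_add_two (n := h)
    have f3 : Nat.fib (h + 1 + 2) = _ := Nat.fib_add_two (n := h + 1)
    have hm : Nat.fib (h + 1) ≤ 2 * Nat.fib h := by
      obtain ⟨m, rfl⟩ := Nat.exists_eq_add_of_le' (by omega : 1 ≤ h)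
      exact fib_add_two_le m
    have h3 : 3 * Nat.fib (h + 1 + 2) ≤ 5 * Nat.fib (h + 2) := by
      rw [f3]
      change 3 * (Nat.fib (h + 1) + Nat.fib (h + 2)) ≤ _
      omega
    have h4 : 5 * (h + 1) ≤ 6 * h := by omega
    have h5 : 3 * (4 * (h + 1) * Nat.fib (h + 1 + 2)) ≤ 3 * 2 ^ (h + 1) := by
      calc 3 * (4 * (h + 1) * Nat.fib (h + 1 + 2)) = 4 * (h + 1) * (3 * Nat.fib (h + 1 + 2)) := by
            ring
        _ ≤ 4 * (h + 1) * (5 * Nat.fib (h + 2)) := Nat.mul_le_mul_left _ h3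
        _ = 4 * (5 * (h + 1)) * Nat.fib (h + 2) := by ring
        _ ≤ 4 * (6 * h) * Nat.fib (h + 2) := by gcongr
        _ = 6 * (4 * h * Nat.fib (h + 2)) := by ring
        _ ≤ 6 * 2 ^ h := Nat.mul_le_mul_left _ ih
        _ = 3 * 2 ^ (h + 1) := by ring
    omega

/-- The gap between the two Steiner costs. -/
lemma cost_gap {h : ℕ} (hh : 24 ≤ h) {α : ℝ} (hα : α ≤ 5 / 3 - 1 / (2 * h)) :
    α * ((3 * 2 ^ h - 2 * Nat.fib (h + 2)) + 1) <
      5 * 2 ^ h - 2 * (Nat.fib (h + 4) : ℝ) + Nat.fib (h + 2) := by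
  have hF : (4 * h * Nat.fib (h + 2) : ℝ) ≤ 2 ^ h := by exact_mod_cast four_mul_fib_le hh
  have hh' : (24 : ℝ) ≤ h := by exact_mod_cast hh
  have hpos : (1 : ℝ) ≤ Nat.fib (h + 2) := by
    exact_mod_cast Nat.fib_pos.2 (by omega : 0 < h + 2)
  have g4 : (Nat.fib (h + 4) : ℝ) ≤ 3 * Nat.fib (h + 2) := by
    have e3 := Nat.fib_add_two (n := h + 1)
    have e4 := Nat.fib_add_two (n := h + 2)
    have := Nat.fib_mono (Nat.le_succ (h + 1))
    exact_mod_cast (by simp only [Nat.succ_eq_add_one, add_assoc, Nat.reduceAdd] at *; omega :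
      Nat.fib (h + 4) ≤ 3 * Nat.fib (h + 2))
  set F : ℝ := (Nat.fib (h + 2) : ℝ) with hFdef
  set X : ℝ := 2 ^ h with hX
  have hFX : 96 * F ≤ X := by nlinarith
  have htree : 0 ≤ 3 * X - 2 * F + 1 := by linarith
  have h1 : α * (3 * X - 2 * F + 1) ≤ (5 / 3 - 1 / (2 * h)) * (3 * X - 2 * F + 1) :=
    mul_le_mul_of_nonneg_right hα htree
  have h2 : 4 * F ≤ 1 / (2 * h) * (3 * X - 2 * F + 1) := by
    rw [div_mul_eq_mul_div, one_mul, le_div_iff₀ (by positivity)]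
    nlinarith
  linarith

lemma scaled_sq_le {a D X s : ℝ} (ha : 0 ≤ a) (hD : 0 < D) (hX : 0 < X)
    (h : a ≤ 2 * D * X * s) : 1 / (200 * D ^ 2) * (a ^ 2 / X ^ 2) ≤ s ^ 2 / 50 := by
  calc 1 / (200 * D ^ 2) * (a ^ 2 / X ^ 2)
      ≤ 1 / (200 * D ^ 2) * ((2 * D * X * s) ^ 2 / X ^ 2) := by gcongr
    _ = s ^ 2 / 50 := by
        field_simp
        ring

/-- The lower bound for fixed `n`, in terms of the size `s` of the groups. -/
theorem le_expectedQueries_of_estimates {Ω : Type*} [MeasurableSpace Ω]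
    (μ : MeasureTheory.Measure Ω) [MeasureTheory.IsProbabilityMeasure μ] {n k h s : ℕ}
    (A : RandomizedAlgorithm (Fin n) Ω) {α : ℝ} (hA : A.Estimates μ k α (51 / 100))
    (hh : 24 ≤ h) (hα : α ≤ 5 / 3 - 1 / (2 * h)) (hα0 : 0 ≤ α) (hk : 2 ^ h ≤ k)
    (hs : 0 < s) (hn : k + h * 2 ^ h * s ≤ n) :
    ∃ (T : Finset (Fin n)) (m : Metric (Fin n)), T.card = k ∧
      ENNReal.ofReal ((s : ℝ) ^ 2 / 50) ≤ A.expectedQueries μ T m := by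
  have hkn : k ≤ n := by have := Nat.zero_le (h * 2 ^ h * s); omega
  have hk0 : (1 : ℝ) ≤ k := by
    have : 0 < 2 ^ h := by positivity
    exact_mod_cast (by omega : 1 ≤ k)
  -- All surplus terminals together then cost at most `1`, the `+ 1` in `cost_gap`.
  obtain ⟨δ, hδ⟩ : ∃ δ : ℝ, δ = 1 / (2 * k) := ⟨_, rfl⟩
  have h0 : 0 < δ := by rw [hδ]; positivity
  have h1 : δ ≤ 1 := by
    rw [hδ, div_le_one (by positivity)]
    linarith
  have hkδ : k * (2 * δ) = 1 := by rw [hδ]; field_simp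
  have : Nonempty (Fin s) := ⟨⟨0, hs⟩⟩
  let ρ : (Fin (h * 2 ^ h) → Fin s) → ℕ → ℕ := fun r g =>
    if hg : g < h * 2 ^ h then r ⟨g, hg⟩ else 0
  have hρ : ∀ r (g : Fin (h * 2 ^ h)), ρ r g = r g := fun r g => by simp [ρ]
  refine ⟨terminals n k, (placement n k h).plainMetric h0 h1, card_terminals hkn, ?_⟩
  have := A.le_expectedQueries μ hA (card_terminals hkn) ((placement n k h).plainMetric h0 h1)
    (fun r => shortcutMetric n k h h0 h1 (ρ r)) (q := s ^ 2) ?_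
    (fun u v => card_choices_mul_le h0 h1 u v ρ hρ)
  · push_cast at this
    exact this
  · intro r
    have hup := steinerCost_shortcutMetric_le (ρ := ρ r) h0 h1 hk hn fun g hg => by
      rw [hρ r ⟨g, hg⟩]
      exact (r ⟨g, hg⟩).2
    have hlow := (placement n k h).le_steinerCost_plainMetric h0 h1 (by omega : 1 ≤ h)
      (terminals n k) (fun t ht => if_pos (Finset.mem_filter.1 ht).2) (fun p hp =>
        ⟨⟨p, by omega⟩, by simp [terminals]; omega, by simp [placement, hp]; omega⟩)
    obtain ⟨h', rfl⟩ := Nat.exists_eq_add_of_le' (by omega : 1 ≤ h)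
    rw [sum_depth_diff_mul, hkδ] at hup
    exact ((mul_le_mul_of_nonneg_left hup hα0).trans_lt (cost_gap hh hα)).trans_le hlow

/-- A height of order `1 / (2 * ε)` suffices. -/
lemma exists_height {ε : ℝ} (hε : 0 < ε) : ∃ h : ℕ, 24 ≤ h ∧ 1 / (2 * (h : ℝ)) ≤ ε ∧
    (2 : ℝ) ^ h ≤ 2 ^ 26 * (2 : ℝ) ^ (1 / ε) ∧
    (h : ℝ) * 2 ^ h ≤ 25 * 2 ^ 26 * (2 : ℝ) ^ (1 / ε) := by
  obtain ⟨m, hm⟩ : ∃ m, m = ⌈1 / (2 * ε)⌉₊ := ⟨_, rfl⟩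
  obtain ⟨X, hX⟩ : ∃ X, X = (2 : ℝ) ^ (1 / ε) := ⟨_, rfl⟩
  have hm1 : 1 / (2 * ε) ≤ m := hm ▸ Nat.le_ceil _
  have hm2 : (m : ℝ) < 1 / (2 * ε) + 1 := hm ▸ Nat.ceil_lt_add_one (by positivity)
  have h4m : (4 : ℝ) ^ m ≤ 4 * X := by
    calc (4 : ℝ) ^ m = (2 : ℝ) ^ (2 * (m : ℝ)) := by
          rw [Real.rpow_mul (by norm_num), Real.rpow_natCast]
          norm_num
      _ ≤ (2 : ℝ) ^ (1 / ε + 2) := by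
          refine Real.rpow_le_rpow_of_exponent_le (by norm_num) ?_
          have : 2 * (1 / (2 * ε)) = 1 / ε := by field_simp
          linarith
      _ = 4 * X := by
          rw [Real.rpow_add (by norm_num), ← hX]
          norm_num
          ring
  have h2m : (1 : ℝ) ≤ 2 ^ m := one_le_pow₀ (by norm_num)
  have h24 : (2 : ℝ) ^ m * 2 ^ m = 4 ^ m := by rw [← mul_pow]; norm_num
  have hm' : (m : ℝ) ≤ 2 ^ m := by exact_mod_cast Nat.lt_two_pow_self.le
  rw [← hX]
  -- `m ≈ 1 / (2 * ε)` gives `1 / (2 * h) ≤ ε`, and half the exponent `1 / ε` remains to absorb the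
  -- factor `h`.
  refine ⟨m + 24, by omega, ?_, ?_, ?_⟩
  · have hmε : 1 / (2 * ε) ≤ (m + 24 : ℕ) := by push_cast; linarith
    have h0 : (0 : ℝ) < (m + 24 : ℕ) := by positivity
    rw [div_le_iff₀ (by positivity)] at hmε ⊢
    linarith
  · calc (2 : ℝ) ^ (m + 24) = 2 ^ 24 * 2 ^ m := by rw [pow_add, mul_comm]
      _ ≤ 2 ^ 24 * 4 ^ m := by gcongr; norm_num
      _ ≤ 2 ^ 24 * (4 * X) := by gcongr
      _ = 2 ^ 26 * X := by ring
  · calc ((m + 24 : ℕ) : ℝ) * 2 ^ (m + 24) = (m + 24) * (2 ^ m * 2 ^ 24) := by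
          rw [pow_add]; push_cast; rfl
      _ ≤ (25 * 2 ^ m) * (2 ^ m * 2 ^ 24) := by gcongr; linarith
      _ = 25 * 2 ^ 24 * 4 ^ m := by rw [← h24]; ring
      _ ≤ 25 * 2 ^ 24 * (4 * X) := by gcongr
      _ = 25 * 2 ^ 26 * X := by ring

end SteinerQuery

/-! ### The main theorem -/

theorem theorem1p1 :
    ∃ c : ℝ, 0 < c ∧ ∃ C : ℝ, 0 < C ∧
      ∀ ε : ℝ, 0 < ε → ε < 2 / 3 →
      ∀ k : ℕ, C * (2 : ℝ) ^ (1 / ε) ≤ (k : ℝ) →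
      ∃ n₀ : ℕ, ∀ n : ℕ, n₀ ≤ n →
      ∀ (Ω : Type*) [MeasurableSpace Ω] (μ : MeasureTheory.Measure Ω)
        [MeasureTheory.IsProbabilityMeasure μ]
        (A : SteinerQuery.RandomizedAlgorithm (Fin n) Ω),
        A.Estimates μ k (5 / 3 - ε) (51 / 100) →
        ∃ (T : Finset (Fin n)) (m : SteinerQuery.Metric (Fin n)), T.card = k ∧
          ENNReal.ofReal (c * ((n : ℝ) ^ 2 / (4 : ℝ) ^ (1 / ε))) ≤
            A.expectedQueries μ T m := by
  -- There are at most `25 * 2 ^ 26 * X` groups, where `X = 2 ^ (1 / ε)`; `200` is `50` times the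
  -- square of the `2` in `n ≤ 2 * (M * s)`.
  refine ⟨1 / (200 * (25 * 2 ^ 26) ^ 2), by positivity, 2 ^ 26, by positivity, ?_⟩
  intro ε hε hε' k hk
  obtain ⟨h, hh, hhε, hhk, hhM⟩ := SteinerQuery.exists_height hε
  have hX4 : (4 : ℝ) ^ (1 / ε) = ((2 : ℝ) ^ (1 / ε)) ^ 2 := by
    rw [← Real.rpow_natCast, ← Real.rpow_mul (by norm_num), mul_comm (1 / ε),
      Real.rpow_mul (by norm_num)]
    norm_num
  rw [hX4]
  have hX0 : (0 : ℝ) < (2 : ℝ) ^ (1 / ε) := by positivity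
  generalize (2 : ℝ) ^ (1 / ε) = X at *
  have hkh : 2 ^ h ≤ k := by exact_mod_cast hhk.trans hk
  obtain ⟨M, hM⟩ : ∃ M, M = h * 2 ^ h := ⟨_, rfl⟩
  have hM0 : 0 < M := hM ▸ Nat.mul_pos (by omega) (by positivity)
  have hMX : (M : ℝ) ≤ 25 * 2 ^ 26 * X := by
    rw [hM]
    push_cast
    exact hhM
  -- This makes terminals and the rounding in `s` cost at most half of the `n` vertices.
  refine ⟨2 * (k + M), fun n hn Ω _ μ _ A hA => ?_⟩
  obtain ⟨s, hs⟩ : ∃ s, s = (n - k) / M := ⟨_, rfl⟩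
  have hsM : M * s ≤ n - k := hs ▸ Nat.mul_div_le _ _
  have hsM' : n - k < M * s + M := by
    have := Nat.lt_mul_div_succ (n - k) hM0
    rwa [← hs, mul_add, mul_one] at this
  have hs0 : 0 < s := hs ▸ Nat.div_pos (by omega) hM0
  obtain ⟨T, w, hT, hle⟩ := SteinerQuery.le_expectedQueries_of_estimates μ A hA (h := h) (s := s)
    hh (by linarith) (by linarith) hkh hs0 (by rw [← hM]; omega)
  refine ⟨T, w, hT, le_trans (ENNReal.ofReal_le_ofReal ?_) hle⟩
  have hn2 : (n : ℝ) ≤ 2 * (M * s) := by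
    exact_mod_cast (by omega : n ≤ 2 * (M * s))
  have hMs := mul_le_mul_of_nonneg_right hMX (Nat.cast_nonneg (α := ℝ) s)
  exact SteinerQuery.scaled_sq_le (Nat.cast_nonneg n) (by positivity) hX0 (by linarith)
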